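/- Let $S=\{a_n\}_{n\ge 1}$ be a sequence of complex numbers with $0<|a_1|\le|a_2|\le\dots\to\infty$ and finite exponent of convergence $\alpha=\limsup_{n\to\infty}\frac{\ln n}{\ln|a_n|}$, and let $\Psi\in[-\pi,\pi)$ be such that, for some $\varepsilon>0$, no argument (mod $2\pi$) of any $a_n$ lies in $(\Psi-\varepsilon,\Psi+\varepsilon)$. Powers $z^{-s}$ of complex numbers are defined with branch cut on the ray $\{te^{i\Psi}:t\ge 0\}$ and $\arg z\in(\Psi-2\pi,\Psi)$; for real $t>0$, $t^{-s}=e^{-s\ln t}$. Put $$\zeta_S(s)=\sum_{n=1}^\infty a_n^{-s},\qquad \Re(s)>\alpha,$$ and let $$H(z)=\prod_{n=1}^\infty\Big(1-\frac{z}{a_n}\Big)\exp\Big[\sum_{j=1}^{\lfloor\alpha\rfloor}\frac1j\Big(\frac{z}{a_n}\Big)^j\Big]$$ be the Hadamard product of $S$. The growth order of an entire function $F$ is the infimum of all $\rho\ge 0$ with $F(z)=O(e^{|z|^\rho})$ as $|z|\to\infty$. A characteristic function of minimal order is an entire function $F$ whose zeros, counted with multiplicity, are the terms of $S$, and whose growth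 order equals that of $H$. Here $\frac{d}{dz}\ln F$ denotes the logarithmic derivative $F'/F$, and $\frac{d}{dt}\ln F(te^{i\Psi})=e^{i\Psi}F'(te^{i\Psi})/F(te^{i\Psi})$. (1) Let $F$ be a characteristic function of minimal order and $0<R<|a_1|$. Let $C_R$ be the circle of radius $R$ traversed counterclockwise, $z=Re^{i\theta}$ from $\theta=\Psi-2\pi$ to $\theta=\Psi$. Then, for $\Re(s)>\alpha$, the series for $\zeta_S(s)$ and the integrals below converge absolutely, and $$\zeta_S(s)=e^{is(\pi-\Psi)}\frac{\sin(\pi s)}{\pi}\int_R^\infty t^{-s}\frac{d}{dt}\ln F(te^{i\Psi})\,dt-\frac{1}{2\pi i}\int_{C_R}z^{-s}\frac{d}{dz}\ln F(z)\,dz .$$ (2) If moreover $\alpha<1$, then, for $\alpha<\Re(s)<1$, with an absolutely convergent integral, $$\zeta_S(s)=e^{is(\pi-\Psi)}\frac{\sin(\pi s)}{\pi}\int_0^\infty t^{-s}\frac{d}{dt}\ln F(te^{i\Psi})\,dt .$$ (3) For $F=H$ and any $\alpha$, the formula in (2) holds, with an absolutely convergent integral, for $\alpha<\Re(s)<\lfloor\alpha\rfloor+1$.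 -/

import Mathlib

open Filter Topology

noncomputable section

namespace SeqZeta

/-- The exponent of convergence `limsup (ln n) / (ln |a_n|)` of a complex sequence. The sequence
`a₁, a₂, …` is indexed from zero, so `a n` is its `(n + 1)`-st term. The upper limit is taken in
the extended reals, so that it exists for every sequence. -/
def convergenceExponent (a : ℕ → ℂ) : EReal :=
  limsup (fun n : ℕ => ((Real.log ((n : ℝ) + 1) / Real.log ‖a n‖ : ℝ) : EReal)) atTop

/-- The points none of whose arguments lies in `(Ψ - ε, Ψ + ε)`; arguments are determined up to
multiples of `2π`, so this is the complement of an open sector around the ray in direction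
`e^{iΨ}`, also when `Ψ` is close to `±π`. -/
def sectorCompl (Ψ ε : ℝ) : Set ℂ :=
  {z : ℂ | ∀ θ : ℝ, z = (‖z‖ : ℂ) * Complex.exp ((θ : ℂ) * Complex.I) →
    θ ∉ Set.Ioo (Ψ - ε) (Ψ + ε)}

/-- The sequences with an associated zeta function: `0 < |a₁| ≤ |a₂| ≤ … → ∞`, with finite
exponent of convergence `α`, and with values outside some open sector around the ray in direction
`e^{iΨ}`, where `Ψ ∈ [-π, π)`. -/
structure IsZetaSequence (a : ℕ → ℂ) (α Ψ : ℝ) : Prop where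
  norm_pos : 0 < ‖a 0‖
  norm_mono : Monotone fun n => ‖a n‖
  tendsto_norm : Tendsto (fun n => ‖a n‖) atTop atTop
  exponent : convergenceExponent a = (α : EReal)
  direction : Ψ ∈ Set.Ico (-Real.pi) Real.pi
  sector : ∃ ε : ℝ, 0 < ε ∧ ∀ n, a n ∈ sectorCompl Ψ ε

/-- The logarithm with branch cut on the ray `{t e^{iΨ} : t ≥ 0}` whose imaginary part lies in
`(Ψ - 2π, Ψ]`. -/
def cutLog (Ψ : ℝ) (z : ℂ) : ℂ :=
  Complex.log (z * Complex.exp (((Real.pi - Ψ : ℝ) : ℂ) * Complex.I))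
    - ((Real.pi - Ψ : ℝ) : ℂ) * Complex.I

/-- The power `z ^ w` with branch cut on the ray `{t e^{iΨ} : t ≥ 0}` and arguments in
`(Ψ - 2π, Ψ]`. -/
def cutPow (Ψ : ℝ) (z w : ℂ) : ℂ :=
  Complex.exp (w * cutLog Ψ z)

/-- The zeta function `∑ a_n ^ (-s)` of a sequence. -/
def zeta (a : ℕ → ℂ) (Ψ : ℝ) (s : ℂ) : ℂ :=
  ∑' n, cutPow Ψ (a n) (-s)

/-- The elementary factor `E(u, p) = (1 - u) exp (u + u² / 2 + ⋯ + u ^ p / p)`. -/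
def elementaryFactor (u : ℂ) (p : ℕ) : ℂ :=
  (1 - u) * Complex.exp (∑ j ∈ Finset.Icc 1 p, u ^ j / (j : ℂ))

/-- The Hadamard product `∏ E(z / a_n, ⌊α⌋)` over the terms of a sequence whose exponent of
convergence is `α`. -/
def hadamard (a : ℕ → ℂ) (α : ℝ) (z : ℂ) : ℂ :=
  ∏' n, elementaryFactor (z / a n) ⌊α⌋₊

/-- The growth order of an entire function: the infimum of all `ρ ≥ 0` such that
`F z = O(exp (|z| ^ ρ))` as `|z| → ∞`. -/
def growthOrder (F : ℂ → ℂ) : ENNReal :=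
  ⨅ (ρ : NNReal) (_ : F =O[Bornology.cobounded ℂ] fun z => Real.exp (‖z‖ ^ (ρ : ℝ))),
    (ρ : ENNReal)

/-- The characteristic functions of a sequence that are of minimal order: the entire functions
whose zeros, with multiplicities, are the terms of the sequence, and which have the same growth
order as the Hadamard product. -/
structure IsMinimalCharacteristic (a : ℕ → ℂ) (α : ℝ) (F : ℂ → ℂ) : Prop where
  entire : Differentiable ℂ F
  zeros : ∀ z, analyticOrderAt F z = {n : ℕ | a n = z}.encard
  order : growthOrder F = growthOrder (hadamard a α)

/-- The integrand `t ^ (-s) (d/dt) ln F(t e^{iΨ})` on the ray. -/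
def rayIntegrand (F : ℂ → ℂ) (Ψ : ℝ) (s : ℂ) (t : ℝ) : ℂ :=
  (t : ℂ) ^ (-s) *
    logDeriv (fun u : ℝ => F ((u : ℂ) * Complex.exp ((Ψ : ℂ) * Complex.I))) t

/-- The integrand of `∫ z ^ (-s) (d/dz) ln F(z) dz` in the parametrization `z = R e^{iθ}`. -/
def circleIntegrand (F : ℂ → ℂ) (Ψ R : ℝ) (s : ℂ) (θ : ℝ) : ℂ :=
  deriv (circleMap 0 R) θ * (cutPow Ψ (circleMap 0 R θ) (-s) * logDeriv F (circleMap 0 R θ))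

/-- The factor `e^{is(π - Ψ)} sin(πs) / π` in front of the integral along the ray. -/
def rayFactor (Ψ : ℝ) (s : ℂ) : ℂ :=
  Complex.exp (Complex.I * s * ((Real.pi : ℂ) - (Ψ : ℂ))) *
    (Complex.sin ((Real.pi : ℂ) * s) / (Real.pi : ℂ))

end SeqZeta

end

noncomputable section

namespace SeqZeta

/-! Put p = ⌊α⌋. The logarithmic derivative of the Hadamard product is the sum over n of z^p /
(a_n^p (z - a_n)) (`IsZetaSequence.logDeriv_hadamard`). Each term has a single pole, with residue 1
at a_n, so a keyhole integral of z^(-s) against it produces a_n^(-s); summing over n gives the zeta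
function.

For one term, w = log z turns the slit annulus into a rectangle of height 2π. Its vertical edges are
the two circles, its horizontal edges the two sides of the slit, on which z^(-s) differs by the
factor e^(2πis); this jump is the source of `rayFactor` (`keyhole_eq_rectIntegral`, `keyhole_pole`).
The term has size |z|^(p-1) at infinity and |z|^p at zero, so the outer circle disappears in the
limit when Re s > p and the inner one when Re s < p + 1.

Summation and integration may be exchanged because the a_n avoid a sector around the ray, whence |t
e^(iΨ) - a_n| ≥ c (t + |a_n|). By scaling, the n-th ray integral is at most a constant times
|a_n|^(-σ) with σ > α (`ray_hasSum`).

For a general F of minimal order, F'/F differs from the sum of the terms by a polynomial of degree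
less than p (`IsMinimalCharacteristic.exists_logDeriv_eq`), which is Hadamard's factorization
theorem in logarithmic form. The keyhole integral of z^(-s) against that polynomial vanishes
(`keyhole_entire_Ioi`). On the whole ray, however, a nonzero polynomial is not integrable near zero
against t^(-s) when Re s > p, so there it must be absent: either p = 0 or F = H. -/

variable {a : ℕ → ℂ} {α Ψ : ℝ}

/-! ### Convergence exponent and distance of the sequence from the ray -/

theorem IsZetaSequence.norm_pos' (ha : IsZetaSequence a α Ψ) (n : ℕ) : 0 < ‖a n‖ :=
  ha.norm_pos.trans_le (ha.norm_mono (Nat.zero_le n))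

theorem IsZetaSequence.ne_zero (ha : IsZetaSequence a α Ψ) (n : ℕ) : a n ≠ 0 :=
  norm_pos_iff.1 (ha.norm_pos' n)

theorem IsZetaSequence.exponent_nonneg (ha : IsZetaSequence a α Ψ) : 0 ≤ α := by
  have h : (0 : EReal) ≤ convergenceExponent a := by
    unfold convergenceExponent
    refine le_trans ?_ (liminf_le_limsup (f := atTop))
    refine le_liminf_of_le (by isBoundedDefault) ?_
    filter_upwards [ha.tendsto_norm.eventually_ge_atTop 1] with n hn
    exact EReal.coe_nonneg.2 (div_nonneg (Real.log_nonneg (by linarith [n.cast_nonneg (α := ℝ)]))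
      (Real.log_nonneg hn))
  rw [ha.exponent] at h
  exact_mod_cast h

/-- For α < τ < σ the definition of the exponent gives n + 1 ≤ |a_n|^τ eventually, so |a_n|^(-σ) ≤
(n + 1)^(-σ/τ) with σ/τ > 1. -/
theorem IsZetaSequence.summable_rpow (ha : IsZetaSequence a α Ψ) {σ : ℝ} (hσ : α < σ) :
    Summable fun n => ‖a n‖ ^ (-σ) := by
  obtain ⟨τ, h1, h2⟩ := exists_between hσ
  have hτ : 0 < τ := ha.exponent_nonneg.trans_lt h1
  have hlt : convergenceExponent a < (τ : EReal) := by
    rw [ha.exponent]; exact_mod_cast h1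
  have hev := eventually_lt_of_limsup_lt hlt
  have hs : Summable fun n : ℕ => ((n : ℝ) + 1) ^ (-(σ / τ)) := by
    have := (Real.summable_nat_rpow (p := -(σ / τ))).2 (by
      have : 1 < σ / τ := (one_lt_div hτ).2 h2
      linarith)
    exact_mod_cast (summable_nat_add_iff 1).2 this
  refine Summable.of_norm_bounded_eventually_nat hs ?_
  filter_upwards [hev, ha.tendsto_norm.eventually_gt_atTop 1] with n hn hn1
  have hlog : 0 < Real.log ‖a n‖ := Real.log_pos hn1
  have hn' : Real.log ((n : ℝ) + 1) / Real.log ‖a n‖ < τ := by exact_mod_cast hn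
  rw [div_lt_iff₀ hlog] at hn'
  have hpos : (0 : ℝ) < (n : ℝ) + 1 := by positivity
  have ha0 := ha.norm_pos' n
  rw [Real.norm_of_nonneg (by positivity), Real.rpow_def_of_pos ha0, Real.rpow_def_of_pos hpos]
  apply Real.exp_le_exp.2
  have : Real.log ((n : ℝ) + 1) * (σ / τ) ≤ (τ * Real.log ‖a n‖) * (σ / τ) := by
    gcongr
    exact div_nonneg (hτ.trans h2).le hτ.le
  have e : (τ * Real.log ‖a n‖) * (σ / τ) = Real.log ‖a n‖ * σ := by field_simp
  linarith

/-- A point whose argument stays away from that of a ray has distance to the points of the ray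
comparable to the sum of the norms. -/
theorem exists_mul_add_norm_le_of_mem_sectorCompl {ε : ℝ} (hε : 0 < ε) :
    ∃ c : ℝ, 0 < c ∧ ∀ z ∈ sectorCompl Ψ ε, ∀ t : ℝ, 0 ≤ t →
      c * (t + ‖z‖) ≤ ‖(t : ℂ) * Complex.exp ((Ψ : ℂ) * Complex.I) - z‖ := by
  set δ := min ε (Real.pi / 2) with hδ
  have hδ0 : 0 < δ := lt_min hε (by positivity)
  have hδπ : δ ≤ Real.pi / 2 := min_le_right _ _
  have hc1 : Real.cos δ < 1 := by
    rw [← Real.cos_zero]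
    exact Real.cos_lt_cos_of_nonneg_of_le_pi le_rfl (by linarith [Real.pi_pos]) hδ0
  -- The constant is optimal for the angle δ: with r = |z|, the difference t² + r² - 2tr cos δ - ((1
  -- - cos δ)/2)(t + r)² equals ((1 + cos δ)/2)(t - r)².
  refine ⟨Real.sqrt ((1 - Real.cos δ) / 2), Real.sqrt_pos.2 (by linarith), ?_⟩
  intro z hz t ht
  set b := z * Complex.exp ((-Ψ : ℝ) * Complex.I) with hb
  have hzb : z = b * Complex.exp ((Ψ : ℂ) * Complex.I) := by
    rw [hb, mul_assoc, ← Complex.exp_add]; simp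
  have hnb : ‖b‖ = ‖z‖ := by rw [hb, norm_mul, Complex.norm_exp_ofReal_mul_I, mul_one]
  have hφ : δ ≤ |b.arg| := by
    by_contra! hlt
    refine hz (Ψ + b.arg) ?_ ?_
    · have := Complex.norm_mul_exp_arg_mul_I b
      rw [hnb] at this
      push_cast
      rw [add_mul, Complex.exp_add, mul_left_comm, this, mul_comm, ← hzb]
    · have := abs_lt.1 (hlt.trans_le (min_le_left _ _))
      constructor <;> linarith [this.1, this.2]
  have hcos : Real.cos b.arg ≤ Real.cos δ := by
    rw [← Real.cos_abs b.arg]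
    exact Real.cos_le_cos_of_nonneg_of_le_pi hδ0.le (Complex.abs_arg_le_pi b) hφ
  have hre : b.re = ‖z‖ * Real.cos b.arg := by
    rw [← hnb, Complex.norm_mul_cos_arg]
  have e : (t : ℂ) * Complex.exp ((Ψ : ℂ) * Complex.I) - z =
      ((t : ℂ) - b) * Complex.exp ((Ψ : ℂ) * Complex.I) := by
    rw [sub_mul, ← hzb]
  rw [e, norm_mul, Complex.norm_exp_ofReal_mul_I, mul_one]
  have hsq : ‖(t : ℂ) - b‖ ^ 2 = t ^ 2 + ‖z‖ ^ 2 - 2 * t * (‖z‖ * Real.cos b.arg) := by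
    rw [← hre, ← hnb, ← Complex.normSq_eq_norm_sq, ← Complex.normSq_eq_norm_sq,
      Complex.normSq_apply, Complex.normSq_apply]
    simp
    ring
  refine le_of_sq_le_sq ?_ (norm_nonneg _)
  rw [mul_pow, Real.sq_sqrt (by linarith), hsq]
  have h1 : t * ‖z‖ * Real.cos b.arg ≤ t * ‖z‖ * Real.cos δ := by gcongr
  have h2 := mul_nonneg (by linarith [Real.neg_one_le_cos δ] : 0 ≤ 1 + Real.cos δ)
    (sq_nonneg (t - ‖z‖))
  nlinarith

theorem IsZetaSequence.exists_sector_bound (ha : IsZetaSequence a α Ψ) :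
    ∃ c : ℝ, 0 < c ∧ ∀ n (t : ℝ), 0 ≤ t →
      c * (t + ‖a n‖) ≤ ‖(t : ℂ) * Complex.exp ((Ψ : ℂ) * Complex.I) - a n‖ := by
  obtain ⟨ε, hε, h⟩ := ha.sector
  obtain ⟨c, hc, hb⟩ := exists_mul_add_norm_le_of_mem_sectorCompl (Ψ := Ψ) hε
  exact ⟨c, hc, fun n => hb _ (h n)⟩

theorem IsZetaSequence.ray_ne (ha : IsZetaSequence a α Ψ) (n : ℕ) {t : ℝ} (ht : 0 ≤ t) :
    (t : ℂ) * Complex.exp ((Ψ : ℂ) * Complex.I) ≠ a n := by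
  obtain ⟨c, hc, h⟩ := ha.exists_sector_bound
  have := h n t ht
  rw [← sub_ne_zero, ← norm_pos_iff]
  have h2 := ha.norm_pos' n
  exact lt_of_lt_of_le (by positivity) this

/-! ### The logarithm and powers cut along the ray -/

theorem exp_cutLog {z : ℂ} (hz : z ≠ 0) : Complex.exp (cutLog Ψ z) = z := by
  unfold cutLog
  rw [Complex.exp_sub, Complex.exp_log (mul_ne_zero hz (Complex.exp_ne_zero _))]
  exact mul_div_cancel_right₀ _ (Complex.exp_ne_zero _)

theorem cutLog_im_mem (z : ℂ) : (cutLog Ψ z).im ∈ Set.Ioc (Ψ - 2 * Real.pi) Ψ := by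
  unfold cutLog
  have h1 := Complex.neg_pi_lt_log_im (z * Complex.exp (((Real.pi - Ψ : ℝ) : ℂ) * Complex.I))
  have h2 := Complex.log_im_le_pi (z * Complex.exp (((Real.pi - Ψ : ℝ) : ℂ) * Complex.I))
  simp only [Complex.sub_im, Complex.im_ofReal_mul, Complex.I_im, mul_one]
  constructor <;> linarith

theorem cutLog_re {z : ℂ} (hz : z ≠ 0) : (cutLog Ψ z).re = Real.log ‖z‖ := by
  have := congrArg norm (exp_cutLog (Ψ := Ψ) hz)
  rw [Complex.norm_exp] at this
  rw [← this, Real.log_exp]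

theorem cutLog_exp {w : ℂ} (hw : w.im ∈ Set.Ioc (Ψ - 2 * Real.pi) Ψ) :
    cutLog Ψ (Complex.exp w) = w := by
  unfold cutLog
  rw [← Complex.exp_add, Complex.log_exp]
  · ring
  all_goals simp only [Complex.add_im, Complex.im_ofReal_mul, Complex.I_im, mul_one]
  · linarith [hw.1]
  · linarith [hw.2]

/-- The upper endpoint is excluded because a term with argument Ψ would lie on the ray. Hence the
logarithm of each term is strictly between the horizontal edges of the rectangle. -/
theorem IsZetaSequence.cutLog_im_mem (ha : IsZetaSequence a α Ψ) (n : ℕ) :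
    (cutLog Ψ (a n)).im ∈ Set.Ioo (Ψ - 2 * Real.pi) Ψ := by
  have h := SeqZeta.cutLog_im_mem (Ψ := Ψ) (a n)
  refine ⟨h.1, lt_of_le_of_ne h.2 fun he => ha.ray_ne n (t := ‖a n‖) (norm_nonneg _) ?_⟩
  conv_rhs => rw [← exp_cutLog (Ψ := Ψ) (ha.ne_zero n),
    ← Complex.re_add_im (cutLog Ψ (a n)), he, cutLog_re (ha.ne_zero n), Complex.exp_add,
    ← Complex.ofReal_exp, Real.exp_log (ha.norm_pos' n)]

/-- The norm is |z|^(-Re s) e^(Im s · arg z), and the cut argument is at most 3π in absolute value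
because Ψ lies in [-π, π). -/
theorem norm_cutPow_neg_le {z : ℂ} (hz : z ≠ 0) (hΨ : Ψ ∈ Set.Ico (-Real.pi) Real.pi) (s : ℂ) :
    ‖cutPow Ψ z (-s)‖ ≤ Real.exp (3 * Real.pi * |s.im|) * ‖z‖ ^ (-s.re) := by
  unfold cutPow
  rw [Complex.norm_exp, Complex.mul_re, cutLog_re hz, Real.rpow_def_of_pos (norm_pos_iff.2 hz),
    ← Real.exp_add]
  apply Real.exp_le_exp.2
  have h := SeqZeta.cutLog_im_mem (Ψ := Ψ) z
  have h3 : |(cutLog Ψ z).im| ≤ 3 * Real.pi := by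
    rw [abs_le]; constructor <;> linarith [h.1, h.2, hΨ.1, hΨ.2, Real.pi_pos]
  have h4 : s.im * (cutLog Ψ z).im ≤ |s.im| * (3 * Real.pi) := by
    refine (le_abs_self _).trans ?_
    rw [abs_mul]; gcongr
  simp only [Complex.neg_re, Complex.neg_im]
  linarith

theorem IsZetaSequence.summable_cutPow (ha : IsZetaSequence a α Ψ) {s : ℂ} (hs : α < s.re) :
    Summable fun n => cutPow Ψ (a n) (-s) :=
  Summable.of_norm_bounded ((ha.summable_rpow hs).mul_left _)
    fun n => norm_cutPow_neg_le (ha.ne_zero n) ha.direction s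

/-! ### The keyhole contour in logarithmic coordinates -/

/-- The integrand `t ^ (-s) e^{iΨ} q(t e^{iΨ})` on the ray for a general function `q`. -/
def rayTerm (q : ℂ → ℂ) (Ψ : ℝ) (s : ℂ) (t : ℝ) : ℂ :=
  (t : ℂ) ^ (-s) * (Complex.exp ((Ψ : ℂ) * Complex.I) *
    q ((t : ℂ) * Complex.exp ((Ψ : ℂ) * Complex.I)))

/-- The integrand of `∫ z ^ (-s) q(z) dz` along a circle for a general function `q`. -/
def circleTerm (q : ℂ → ℂ) (Ψ R : ℝ) (s : ℂ) (θ : ℝ) : ℂ :=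
  deriv (circleMap 0 R) θ * (cutPow Ψ (circleMap 0 R θ) (-s) * q (circleMap 0 R θ))

/-- The integrand of `∫ z ^ (-s) q(z) dz` in the coordinate `w = log z`. -/
def logTerm (q : ℂ → ℂ) (s w : ℂ) : ℂ :=
  Complex.exp (-s * w) * (q (Complex.exp w) * Complex.exp w)

/-- The integral along the boundary of the rectangle with corners `z` and `w`. -/
def rectIntegral (f : ℂ → ℂ) (z w : ℂ) : ℂ :=
  (∫ x : ℝ in z.re..w.re, f (x + z.im * Complex.I)) -
    (∫ x : ℝ in z.re..w.re, f (x + w.im * Complex.I)) +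
      Complex.I • (∫ y : ℝ in z.im..w.im, f (w.re + y * Complex.I)) -
      Complex.I • (∫ y : ℝ in z.im..w.im, f (z.re + y * Complex.I))

theorem exp_log_add_mul_I {R : ℝ} (hR : 0 < R) (θ : ℝ) :
    Complex.exp (((Real.log R : ℝ) : ℂ) + θ * Complex.I) = circleMap 0 R θ := by
  rw [Complex.exp_add, ← Complex.ofReal_exp, Real.exp_log hR, circleMap, zero_add]

/-- The substitution z = e^w has dz = i z dθ on a circle. The restriction to the half-open interval
is where `cutLog` inverts the exponential; the omitted endpoint is a null set for the integral. -/
theorem circleTerm_eq_logTerm (q : ℂ → ℂ) {R : ℝ} (hR : 0 < R) (s : ℂ) {θ : ℝ}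
    (hθ : θ ∈ Set.Ioc (Ψ - 2 * Real.pi) Ψ) :
    circleTerm q Ψ R s θ =
      Complex.I * logTerm q s (((Real.log R : ℝ) : ℂ) + θ * Complex.I) := by
  unfold circleTerm logTerm
  rw [deriv_circleMap, exp_log_add_mul_I hR, ← exp_log_add_mul_I hR, cutPow, cutLog_exp]
  · ring
  · simpa using hθ

theorem integral_circleTerm_eq (q : ℂ → ℂ) {R : ℝ} (hR : 0 < R) (s : ℂ) :
    ∫ θ in (Ψ - 2 * Real.pi)..Ψ, circleTerm q Ψ R s θ =
      Complex.I • ∫ θ in (Ψ - 2 * Real.pi)..Ψ,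
        logTerm q s (((Real.log R : ℝ) : ℂ) + θ * Complex.I) := by
  rw [← intervalIntegral.integral_smul]
  refine intervalIntegral.integral_congr_ae (.of_forall fun θ hθ => ?_)
  rw [Set.uIoc_of_le (by linarith [Real.pi_pos])] at hθ
  exact circleTerm_eq_logTerm q hR s hθ

theorem logTerm_top (q : ℂ → ℂ) (s : ℂ) (x : ℝ) :
    logTerm q s (x + Ψ * Complex.I) =
      Complex.exp (-s * (Ψ * Complex.I)) * (Real.exp x • rayTerm q Ψ s (Real.exp x)) := by
  unfold logTerm rayTerm
  have h : ((Real.exp x : ℝ) : ℂ) ^ (-s) = Complex.exp (-s * x) := by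
    rw [Complex.cpow_def_of_ne_zero (by exact_mod_cast (Real.exp_pos x).ne'),
      ← Complex.ofReal_log (Real.exp_pos x).le, Real.log_exp, mul_comm]
  rw [h, mul_add, Complex.exp_add, Complex.exp_add, Complex.real_smul, Complex.ofReal_exp]
  ring

/-- The two horizontal edges have the same image under the exponential, so q takes the same values
there; only the power picks up its monodromy around zero. -/
theorem logTerm_bottom (q : ℂ → ℂ) (s : ℂ) (x : ℝ) :
    logTerm q s (x + ((Ψ - 2 * Real.pi : ℝ) : ℂ) * Complex.I) =
      Complex.exp (2 * Real.pi * Complex.I * s) * logTerm q s (x + Ψ * Complex.I) := by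
  unfold logTerm
  have h : (x : ℂ) + ((Ψ - 2 * Real.pi : ℝ) : ℂ) * Complex.I =
    (x + Ψ * Complex.I) - 2 * Real.pi * Complex.I := by push_cast; ring
  have h2 : Complex.exp (-s * ((x + Ψ * Complex.I) - 2 * Real.pi * Complex.I)) =
      Complex.exp (2 * Real.pi * Complex.I * s) * Complex.exp (-s * (x + Ψ * Complex.I)) := by
    rw [← Complex.exp_add]; congr 1; ring
  rw [h, Complex.exp_periodic.sub_eq, h2, mul_assoc]

theorem integral_logTerm_top {q : ℂ → ℂ} {R L : ℝ} (hR : 0 < R) (hRL : R ≤ L) (s : ℂ)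
    (hq : ContinuousOn (fun t : ℝ => q (t * Complex.exp (Ψ * Complex.I))) (Set.Icc R L)) :
    ∫ x in (Real.log R)..(Real.log L), logTerm q s (x + Ψ * Complex.I) =
      Complex.exp (-s * (Ψ * Complex.I)) * ∫ t in R..L, rayTerm q Ψ s t := by
  have hL : 0 < L := hR.trans_le hRL
  simp only [logTerm_top]
  rw [intervalIntegral.integral_const_mul]
  congr 1
  have := intervalIntegral.integral_deriv_smul_comp' (a := Real.log R) (b := Real.log L)
    (f := Real.exp) (f' := Real.exp) (g := rayTerm q Ψ s) (fun x _ => Real.hasDerivAt_exp x)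
    Real.continuous_exp.continuousOn ?_
  · rw [Real.exp_log hR, Real.exp_log hL] at this
    exact this
  · refine ContinuousOn.mono (s := Set.Icc R L) ?_ ?_
    · unfold rayTerm
      refine ContinuousOn.mul (fun t ht => ?_) (continuousOn_const.mul hq)
      exact (Complex.continuousAt_ofReal_cpow_const t (-s)
        (Or.inr (hR.trans_le ht.1).ne')).continuousWithinAt
    · rintro _ ⟨x, hx, rfl⟩
      rw [Set.uIcc_of_le (Real.log_le_log hR hRL)] at hx
      exact ⟨(Real.log_le_iff_le_exp hR).1 hx.1, (Real.le_log_iff_exp_le hL).1 hx.2⟩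

/-- The corner of the logarithmic image of the slit annulus. -/
def logCorner (R θ : ℝ) : ℂ := ⟨Real.log R, θ⟩

/-- The right side is the jump across the slit, lower edge minus upper edge, of the factor of z^(-s)
depending on the argument. -/
theorem rayFactor_eq (s : ℂ) :
    2 * Real.pi * Complex.I * rayFactor Ψ s =
      (Complex.exp (2 * Real.pi * Complex.I * s) - 1) *
        Complex.exp (-s * (Ψ * Complex.I)) := by
  have hπ : (Real.pi : ℂ) ≠ 0 := by exact_mod_cast Real.pi_ne_zero
  unfold rayFactor
  rw [Complex.sin]
  have e1 : Complex.exp (Complex.I * s * (Real.pi - Ψ)) =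
    Complex.exp (s * Real.pi * Complex.I) * Complex.exp (-s * (Ψ * Complex.I)) := by
    rw [← Complex.exp_add]; congr 1; ring
  have e2 : Complex.exp (2 * Real.pi * Complex.I * s) =
    Complex.exp (s * Real.pi * Complex.I) * Complex.exp (s * Real.pi * Complex.I) := by
    rw [← Complex.exp_add]; congr 1; ring
  have e3 : Complex.exp (s * Real.pi * Complex.I) *
      Complex.exp (-(s * Real.pi * Complex.I)) = 1 := by
    rw [← Complex.exp_add]; simp
  rw [e1, e2, show -(Real.pi * s) * Complex.I = -(s * Real.pi * Complex.I) by ring,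
    show Real.pi * s * Complex.I = (s * Real.pi * Complex.I) by ring]
  generalize Complex.exp (s * Real.pi * Complex.I) = X at e3 ⊢
  generalize Complex.exp (-(s * Real.pi * Complex.I)) = Y at e3 ⊢
  field_simp
  linear_combination X * (Y - X) * Complex.I_sq - e3

/-- The integral along the boundary of a slit annulus in logarithmic coordinates. -/
theorem keyhole_eq_rectIntegral {q : ℂ → ℂ} {R L : ℝ} (hR : 0 < R) (hRL : R ≤ L) (s : ℂ)
    (hq : ContinuousOn (fun t : ℝ => q (t * Complex.exp (Ψ * Complex.I))) (Set.Icc R L)) :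
    2 * Real.pi * Complex.I * (rayFactor Ψ s * ∫ t in R..L, rayTerm q Ψ s t) +
      (∫ θ in (Ψ - 2 * Real.pi)..Ψ, circleTerm q Ψ L s θ) -
      (∫ θ in (Ψ - 2 * Real.pi)..Ψ, circleTerm q Ψ R s θ) =
    rectIntegral (logTerm q s) (logCorner R (Ψ - 2 * Real.pi)) (logCorner L Ψ) := by
  have hL : 0 < L := hR.trans_le hRL
  rw [integral_circleTerm_eq q hR, integral_circleTerm_eq q hL]
  simp only [rectIntegral, logCorner, logTerm_bottom]
  rw [intervalIntegral.integral_const_mul, integral_logTerm_top hR hRL s hq, ← mul_assoc,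
    rayFactor_eq]
  ring

theorem keyhole_eq_zero {q : ℂ → ℂ} (hq : Differentiable ℂ q) {R L : ℝ} (hR : 0 < R)
    (hRL : R ≤ L) (s : ℂ) :
    2 * Real.pi * Complex.I * (rayFactor Ψ s * ∫ t in R..L, rayTerm q Ψ s t) +
      (∫ θ in (Ψ - 2 * Real.pi)..Ψ, circleTerm q Ψ L s θ) -
      (∫ θ in (Ψ - 2 * Real.pi)..Ψ, circleTerm q Ψ R s θ) = 0 := by
  rw [keyhole_eq_rectIntegral hR hRL]
  · refine Complex.integral_boundary_rect_eq_zero_of_differentiableOn _ _ _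
      (Differentiable.differentiableOn ?_)
    unfold logTerm
    exact Differentiable.mul (by fun_prop)
      ((hq.comp Complex.differentiable_exp).mul Complex.differentiable_exp)
  · have := hq.continuous
    fun_prop

/-! ### The residue of a single pole -/

/-- The function `z ^ p / (a ^ p (z - a))`, the sum of `1 / (z - a)` and of the first `p` terms of
its expansion at zero with the opposite sign. -/
def pole (a : ℂ) (p : ℕ) (z : ℂ) : ℂ := z ^ p / (a ^ p * (z - a))

theorem rectIntegral_congr {f g : ℂ → ℂ} {z w : ℂ} (hr : z.re ≤ w.re) (hi : z.im ≤ w.im)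
    (h : ∀ v : ℂ, (v.re ∈ Set.Icc z.re w.re ∧ (v.im = z.im ∨ v.im = w.im)) ∨
      (v.im ∈ Set.Icc z.im w.im ∧ (v.re = z.re ∨ v.re = w.re)) → f v = g v) :
    rectIntegral f z w = rectIntegral g z w := by
  unfold rectIntegral
  congr 1
  · congr 1
    · congr 1
      · refine intervalIntegral.integral_congr fun x hx => h _ (Or.inl ?_)
        rw [Set.uIcc_of_le hr] at hx
        simpa using hx
      · refine intervalIntegral.integral_congr fun x hx => h _ (Or.inl ?_)
        rw [Set.uIcc_of_le hr] at hx
        simpa using hx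
    · congr 1
      refine intervalIntegral.integral_congr fun x hx => h _ (Or.inr ?_)
      rw [Set.uIcc_of_le hi] at hx
      simpa using hx
  · congr 1
    refine intervalIntegral.integral_congr fun x hx => h _ (Or.inr ?_)
    rw [Set.uIcc_of_le hi] at hx
    simpa using hx

theorem rectIntegral_add {f g : ℂ → ℂ} {z w : ℂ} (hr : z.re ≤ w.re) (hi : z.im ≤ w.im)
    (h : ∀ v : ℂ, (v.re ∈ Set.Icc z.re w.re ∧ (v.im = z.im ∨ v.im = w.im)) ∨
      (v.im ∈ Set.Icc z.im w.im ∧ (v.re = z.re ∨ v.re = w.re)) →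
      ContinuousAt f v ∧ ContinuousAt g v) :
    rectIntegral (fun v => f v + g v) z w = rectIntegral f z w + rectIntegral g z w := by
  have key : ∀ (y : ℝ), (y = z.im ∨ y = w.im) → ∀ φ : ℂ → ℂ, (φ = f ∨ φ = g) →
      IntervalIntegrable (fun x : ℝ => φ (x + y * Complex.I)) MeasureTheory.volume z.re w.re := by
    intro y hy φ hφ
    refine ContinuousOn.intervalIntegrable fun x hx => ContinuousAt.continuousWithinAt ?_
    rw [Set.uIcc_of_le hr] at hx
    have := h (x + y * Complex.I) (Or.inl (by simpa using ⟨hx, hy⟩))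
    refine ContinuousAt.comp (g := φ) ?_ (by fun_prop)
    rcases hφ with rfl | rfl
    exacts [this.1, this.2]
  have key2 : ∀ (x : ℝ), (x = z.re ∨ x = w.re) → ∀ φ : ℂ → ℂ, (φ = f ∨ φ = g) →
      IntervalIntegrable (fun y : ℝ => φ (x + y * Complex.I)) MeasureTheory.volume z.im w.im := by
    intro x hx φ hφ
    refine ContinuousOn.intervalIntegrable fun y hy => ContinuousAt.continuousWithinAt ?_
    rw [Set.uIcc_of_le hi] at hy
    have := h (x + y * Complex.I) (Or.inr (by simpa using ⟨hy, hx⟩))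
    refine ContinuousAt.comp (g := φ) ?_ (by fun_prop)
    rcases hφ with rfl | rfl
    exacts [this.1, this.2]
  unfold rectIntegral
  rw [intervalIntegral.integral_add, intervalIntegral.integral_add, intervalIntegral.integral_add,
    intervalIntegral.integral_add]
  · simp only [smul_add]; ring
  all_goals first
    | exact key _ (Or.inl rfl) _ (Or.inl rfl)
    | exact key _ (Or.inl rfl) _ (Or.inr rfl)
    | exact key _ (Or.inr rfl) _ (Or.inl rfl)
    | exact key _ (Or.inr rfl) _ (Or.inr rfl)
    | exact key2 _ (Or.inl rfl) _ (Or.inl rfl)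
    | exact key2 _ (Or.inl rfl) _ (Or.inr rfl)
    | exact key2 _ (Or.inr rfl) _ (Or.inl rfl)
    | exact key2 _ (Or.inr rfl) _ (Or.inr rfl)

/-- At s = 0 the power is 1 and the integrand is periodic in θ, so the position of the cut is
immaterial. This reduces the residue computation to classical circle integrals. -/
theorem integral_circleTerm_zero (q : ℂ → ℂ) (R : ℝ) :
    ∫ θ in (Ψ - 2 * Real.pi)..Ψ, circleTerm q Ψ R 0 θ = ∮ z in C(0, R), q z := by
  have hp : Function.Periodic (fun θ => deriv (circleMap 0 R) θ • q (circleMap 0 R θ))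
      (2 * Real.pi) := by
    intro θ
    simp only [deriv_circleMap, periodic_circleMap 0 R θ]
  have := hp.intervalIntegral_add_eq (Ψ - 2 * Real.pi) 0
  simp only [sub_add_cancel, zero_add] at this
  rw [circleIntegral, ← this]
  simp [circleTerm, cutPow]

theorem circleIntegral_inv_sub_eq_zero {b : ℂ} {R : ℝ} (hR : 0 ≤ R) (h : R < ‖b‖) :
    ∮ z in C(0, R), (z - b)⁻¹ = 0 := by
  have hd : ∀ z ∈ Metric.closedBall (0 : ℂ) R, DifferentiableAt ℂ (fun z => (z - b)⁻¹) z := by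
    intro z hz
    refine DifferentiableAt.inv (by fun_prop) (sub_ne_zero.2 ?_)
    rintro rfl
    simp at hz
    linarith
  exact Complex.circleIntegral_eq_zero_of_differentiable_on_off_countable hR Set.countable_empty
    (fun z hz => (hd z hz).continuousAt.continuousWithinAt)
    fun z hz => hd z (Metric.ball_subset_closedBall hz.1)

/-- The exponential is injective up to multiples of 2πi, so its difference quotient has no zero off
the diagonal for such w; on the diagonal it is the derivative, again an exponential. -/
theorem dslope_exp_ne_zero {w w₀ : ℂ} (h : |w.im - w₀.im| < 2 * Real.pi) :
    dslope Complex.exp w₀ w ≠ 0 := by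
  by_cases hw : w = w₀
  · subst hw
    rw [dslope_same, Complex.deriv_exp]
    exact Complex.exp_ne_zero _
  · rw [dslope_of_ne _ hw, slope_def_field]
    refine div_ne_zero (sub_ne_zero.2 fun he => hw ?_) (sub_ne_zero.2 hw)
    obtain ⟨n, hn⟩ := Complex.exp_eq_exp_iff_exists_int.1 he
    have him : w.im - w₀.im = n * (2 * Real.pi) := by
      rw [hn]; simp
    rw [him, abs_mul, abs_of_pos (by positivity : 0 < 2 * Real.pi)] at h
    have h1 : |(n : ℝ)| < 1 := by
      by_contra! hc
      nlinarith [Real.pi_pos]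
    have h0 : n = 0 := by
      rw [← Int.abs_lt_one_iff]; exact_mod_cast h1
    simpa [h0] using hn

theorem differentiable_dslope {h : ℂ → ℂ} (hh : Differentiable ℂ h) (w₀ : ℂ) :
    Differentiable ℂ (dslope h w₀) :=
  differentiableOn_univ.1
    ((Complex.differentiableOn_dslope Filter.univ_mem).2 hh.differentiableOn)

/-- The residue theorem on a slit annulus for the function `z ^ (-s) z ^ p / (b ^ p (z - b))`. -/
theorem keyhole_pole {b : ℂ} (hb : (cutLog Ψ b).im ∈ Set.Ioo (Ψ - 2 * Real.pi) Ψ) (p : ℕ)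
    {R L : ℝ} (hR : 0 < R) (hRb : R < ‖b‖) (hbL : ‖b‖ < L) (s : ℂ) :
    2 * Real.pi * Complex.I * (rayFactor Ψ s * ∫ t in R..L, rayTerm (pole b p) Ψ s t) +
      (∫ θ in (Ψ - 2 * Real.pi)..Ψ, circleTerm (pole b p) Ψ L s θ) -
      (∫ θ in (Ψ - 2 * Real.pi)..Ψ, circleTerm (pole b p) Ψ R s θ) =
    2 * Real.pi * Complex.I * cutPow Ψ b (-s) := by
  have hb0 : b ≠ 0 := norm_pos_iff.1 (hR.trans hRb)
  have hRL : R ≤ L := (hRb.trans hbL).le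
  have hL : 0 < L := hR.trans_le hRL
  set w₀ := cutLog Ψ b with hw₀
  have hew₀ : Complex.exp w₀ = b := exp_cutLog hb0
  have hre₀ : w₀.re = Real.log ‖b‖ := cutLog_re hb0
  have hray : ∀ t : ℝ, 0 < t → (t : ℂ) * Complex.exp (Ψ * Complex.I) ≠ b := by
    intro t ht he
    have h1 := congrArg (cutLog Ψ) he
    have h2 : (t : ℂ) * Complex.exp (Ψ * Complex.I) =
      Complex.exp ((Real.log t : ℝ) + Ψ * Complex.I) := by
      rw [Complex.exp_add, ← Complex.ofReal_exp, Real.exp_log ht]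
    rw [h2, cutLog_exp] at h1
    · rw [hw₀, ← h1] at hb
      simp at hb
    · simp [Real.pi_pos]
  have hcont : ∀ p, ContinuousOn (fun t : ℝ => pole b p (t * Complex.exp (Ψ * Complex.I)))
      (Set.Icc R L) := by
    intro p
    unfold pole
    refine ContinuousOn.div (by fun_prop) (by fun_prop) fun t ht => ?_
    exact mul_ne_zero (pow_ne_zero _ hb0) (sub_ne_zero.2 (hray t (hR.trans_le ht.1)))
  -- The boundary of the rectangle avoids w₀, and w₀ is the only logarithm of b in the closed strip.
  have hne : ∀ v : ℂ, (v.re ∈ Set.Icc (Real.log R) (Real.log L) ∧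
      (v.im = Ψ - 2 * Real.pi ∨ v.im = Ψ)) ∨ (v.im ∈ Set.Icc (Ψ - 2 * Real.pi) Ψ ∧
      (v.re = Real.log R ∨ v.re = Real.log L)) → v ≠ w₀ ∧ Complex.exp v ≠ b := by
    intro v hv
    have him : v.im ∈ Set.Icc (Ψ - 2 * Real.pi) Ψ := by
      rcases hv with ⟨-, h | h⟩ | ⟨h, -⟩
      · rw [h]; simp [Real.pi_pos.le]
      · rw [h]; simp [Real.pi_pos.le]
      · exact h
    have h1 : v ≠ w₀ := by
      rintro rfl
      rcases hv with ⟨-, h | h⟩ | ⟨-, h | h⟩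
      · exact hb.1.ne' h
      · exact hb.2.ne h
      · rw [hre₀] at h
        exact (Real.log_lt_log hR hRb).ne' h
      · rw [hre₀] at h
        exact (Real.log_lt_log (hR.trans hRb) hbL).ne h
    refine ⟨h1, fun he => ?_⟩
    have := dslope_exp_ne_zero (w := v) (w₀ := w₀)
      (by rw [abs_lt]; constructor <;> linarith [him.1, him.2, hb.1, hb.2])
    rw [dslope_of_ne _ h1, slope_def_field, he, hew₀, sub_self, zero_div] at this
    exact this rfl
  set h : ℂ → ℂ := fun w => Complex.exp (-s * w) * (Complex.exp w ^ p / b ^ p) with hh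
  have hd : Differentiable ℂ h := by rw [hh]; fun_prop
  -- The integrand is h(w) e^w / (e^w - b). Replacing h(w) by h(w) - h(w₀) cancels the simple pole
  -- at w₀, and the quotient of the two difference quotients is the holomorphic extension across w₀.
  -- What remains is h(w₀) e^w / (e^w - b), the same problem with s = 0 and p = 0.
  set k : ℂ → ℂ := fun w => dslope h w₀ w / dslope Complex.exp w₀ w * Complex.exp w with hk
  have hkd : ∀ v : ℂ, v.im ∈ Set.Icc (Ψ - 2 * Real.pi) Ψ → DifferentiableAt ℂ k v := by
    intro v hv
    refine DifferentiableAt.mul (DifferentiableAt.div (differentiable_dslope hd w₀ v)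
      (differentiable_dslope Complex.differentiable_exp w₀ v) (dslope_exp_ne_zero ?_))
      Complex.differentiableAt_exp
    rw [abs_lt]; constructor <;> linarith [hv.1, hv.2, hb.1, hb.2]
  have hhw : h w₀ = cutPow Ψ b (-s) := by
    simp only [hh, hew₀, cutPow, ← hw₀]
    rw [div_self (pow_ne_zero _ hb0), mul_one]
  have hlogs : (logCorner R (Ψ - 2 * Real.pi)).re ≤ (logCorner L Ψ).re :=
    Real.log_le_log hR hRL
  have hims : (logCorner R (Ψ - 2 * Real.pi)).im ≤ (logCorner L Ψ).im := by
    simp [logCorner, Real.pi_pos.le]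
  have hk0 : rectIntegral k (logCorner R (Ψ - 2 * Real.pi)) (logCorner L Ψ) = 0 := by
    refine Complex.integral_boundary_rect_eq_zero_of_differentiableOn _ _ _ fun v hv => ?_
    refine (hkd v ?_).differentiableWithinAt
    have := hv.2
    rwa [Set.uIcc_of_le hims] at this
  -- At s = 0 the two sides of the slit cancel, as `rayFactor` vanishes there. The circle integrals
  -- of 1/(z - b) are 0 inside and 2πi outside |z| = |b|.
  have hl0 : rectIntegral (logTerm (fun z => cutPow Ψ b (-s) * (z - b)⁻¹) 0)
      (logCorner R (Ψ - 2 * Real.pi)) (logCorner L Ψ) =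
        2 * Real.pi * Complex.I * cutPow Ψ b (-s) := by
    rw [← keyhole_eq_rectIntegral hR hRL, integral_circleTerm_zero, integral_circleTerm_zero]
    · have hm : ∀ r : ℝ, ∮ z in C(0, r), cutPow Ψ b (-s) * (z - b)⁻¹ =
          cutPow Ψ b (-s) * ∮ z in C(0, r), (z - b)⁻¹ := fun r =>
        circleIntegral.integral_const_mul _ _ _ _
      rw [hm, hm, circleIntegral_inv_sub_eq_zero hR.le hRb,
        circleIntegral.integral_sub_inv_of_mem_ball (by simpa using hbL)]
      simp [rayFactor]
      ring
    · refine continuousOn_const.mul (ContinuousOn.inv₀ (by fun_prop) fun t ht => ?_)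
      exact sub_ne_zero.2 (hray t (hR.trans_le ht.1))
  rw [keyhole_eq_rectIntegral hR hRL s (hcont p), ← hl0]
  refine Eq.trans ?_ ((rectIntegral_add (f := k)
    (g := logTerm (fun z => cutPow Ψ b (-s) * (z - b)⁻¹) 0) hlogs hims ?_).trans
    (by rw [hk0, zero_add]))
  · refine rectIntegral_congr hlogs hims fun v hv => ?_
    obtain ⟨h1, h2⟩ := hne v hv
    simp only [hk, logTerm, pole]
    rw [dslope_of_ne _ h1, dslope_of_ne _ h1, slope_def_field, slope_def_field, hhw, hew₀]
    have h3 := sub_ne_zero.2 h1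
    have h4 := sub_ne_zero.2 h2
    simp only [hh]
    field_simp
    rw [mul_zero, neg_zero, Complex.exp_zero]
    ring
  · intro v hv
    refine ⟨(hkd v ?_).continuousAt, ?_⟩
    · rcases hv with ⟨-, h | h⟩ | ⟨h, -⟩
      · simp only [logCorner] at h; rw [h]; simp [Real.pi_pos.le]
      · simp only [logCorner] at h; rw [h]; simp [Real.pi_pos.le]
      · exact h
    · unfold logTerm
      have h4 := sub_ne_zero.2 (hne v hv).2
      fun_prop (disch := assumption)

/-! ### Letting the outer radius tend to infinity and the inner one to zero -/

theorem norm_circleTerm_le (hΨ : Ψ ∈ Set.Ico (-Real.pi) Real.pi) {q : ℂ → ℂ} {R B : ℝ}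
    (hR : 0 < R) (s : ℂ) (h : ∀ z : ℂ, ‖z‖ = R → R * ‖q z‖ ≤ B) (θ : ℝ) :
    ‖circleTerm q Ψ R s θ‖ ≤ Real.exp (3 * Real.pi * |s.im|) * R ^ (-s.re) * B := by
  have hn : ‖circleMap 0 R θ‖ = R := by simp [abs_of_pos hR]
  have h1 := norm_cutPow_neg_le (norm_pos_iff.1 (hn ▸ hR)) hΨ s
  rw [hn] at h1
  have h2 := h _ hn
  unfold circleTerm
  rw [deriv_circleMap, norm_mul, norm_mul, norm_mul, Complex.norm_I, mul_one, hn]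
  calc R * (‖cutPow Ψ (circleMap 0 R θ) (-s)‖ * ‖q (circleMap 0 R θ)‖) =
        ‖cutPow Ψ (circleMap 0 R θ) (-s)‖ * (R * ‖q (circleMap 0 R θ)‖) := by ring
    _ ≤ _ := by gcongr

theorem norm_integral_circleTerm_le (hΨ : Ψ ∈ Set.Ico (-Real.pi) Real.pi) {q : ℂ → ℂ} {R B : ℝ}
    (hR : 0 < R) (s : ℂ) (h : ∀ z : ℂ, ‖z‖ = R → R * ‖q z‖ ≤ B) :
    ‖∫ θ in (Ψ - 2 * Real.pi)..Ψ, circleTerm q Ψ R s θ‖ ≤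
      Real.exp (3 * Real.pi * |s.im|) * R ^ (-s.re) * B * (2 * Real.pi) := by
  have := intervalIntegral.norm_integral_le_of_norm_le_const (a := Ψ - 2 * Real.pi) (b := Ψ)
    (f := circleTerm q Ψ R s) fun θ _ => norm_circleTerm_le hΨ hR s h θ
  rwa [sub_sub_cancel, abs_of_pos Real.two_pi_pos] at this

theorem tendsto_integral_circleTerm_atTop (hΨ : Ψ ∈ Set.Ico (-Real.pi) Real.pi) {q : ℂ → ℂ}
    {C β : ℝ} {s : ℂ} (hβ : β < s.re)
    (h : ∀ᶠ R in atTop, ∀ z : ℂ, ‖z‖ = R → R * ‖q z‖ ≤ C * R ^ β) :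
    Tendsto (fun R => ∫ θ in (Ψ - 2 * Real.pi)..Ψ, circleTerm q Ψ R s θ) atTop (𝓝 0) := by
  have hlim := (tendsto_rpow_neg_atTop (sub_pos.2 hβ)).const_mul
    (Real.exp (3 * Real.pi * |s.im|) * C * (2 * Real.pi))
  rw [mul_zero] at hlim
  refine squeeze_zero_norm' ?_ hlim
  filter_upwards [h, eventually_gt_atTop 0] with R hR h0
  refine (norm_integral_circleTerm_le hΨ h0 s hR).trans_eq ?_
  rw [show -(s.re - β) = -s.re + β by ring, Real.rpow_add h0]
  ring

theorem tendsto_integral_circleTerm_zero (hΨ : Ψ ∈ Set.Ico (-Real.pi) Real.pi) {q : ℂ → ℂ}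
    {C β : ℝ} {s : ℂ} (hβ : s.re < β)
    (h : ∀ᶠ R in 𝓝[>] (0 : ℝ), ∀ z : ℂ, ‖z‖ = R → R * ‖q z‖ ≤ C * R ^ β) :
    Tendsto (fun R => ∫ θ in (Ψ - 2 * Real.pi)..Ψ, circleTerm q Ψ R s θ) (𝓝[>] 0) (𝓝 0) := by
  have hlim0 : Tendsto (fun R : ℝ => R ^ (β - s.re)) (𝓝[>] 0) (𝓝 0) := by
    have := (Real.continuousAt_rpow_const 0 (β - s.re) (Or.inr (sub_pos.2 hβ).le)).tendsto
    rw [Real.zero_rpow (sub_pos.2 hβ).ne'] at this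
    exact this.mono_left nhdsWithin_le_nhds
  have hlim := hlim0.const_mul (Real.exp (3 * Real.pi * |s.im|) * C * (2 * Real.pi))
  rw [mul_zero] at hlim
  refine squeeze_zero_norm' ?_ hlim
  filter_upwards [h, self_mem_nhdsWithin] with R hR h0
  refine (norm_integral_circleTerm_le hΨ h0 s hR).trans_eq ?_
  rw [show β - s.re = -s.re + β by ring, Real.rpow_add h0]
  ring

/-- An entire q encloses no residue, so only the growth condition removing the outer circle matters.
This serves to discard the polynomial part of F'/F. -/
theorem keyhole_entire_Ioi (hΨ : Ψ ∈ Set.Ico (-Real.pi) Real.pi) {q : ℂ → ℂ}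
    (hq : Differentiable ℂ q) {C β R : ℝ} {s : ℂ} (hR : 0 < R) (hβ : β < s.re)
    (h : ∀ᶠ R in atTop, ∀ z : ℂ, ‖z‖ = R → R * ‖q z‖ ≤ C * R ^ β)
    (hint : MeasureTheory.IntegrableOn (rayTerm q Ψ s) (Set.Ioi R)) :
    rayFactor Ψ s * (∫ t in Set.Ioi R, rayTerm q Ψ s t) -
      1 / (2 * (Real.pi : ℂ) * Complex.I) *
        ∫ θ in (Ψ - 2 * Real.pi)..Ψ, circleTerm q Ψ R s θ = 0 := by
  have h2 := ((((MeasureTheory.intervalIntegral_tendsto_integral_Ioi R hint tendsto_id).const_mul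
    (rayFactor Ψ s)).const_mul (2 * Real.pi * Complex.I)).add
    (tendsto_integral_circleTerm_atTop hΨ hβ h)).sub_const
    (∫ θ in (Ψ - 2 * Real.pi)..Ψ, circleTerm q Ψ R s θ)
  have h3 := tendsto_nhds_unique (h2.congr' (f₂ := fun _ => 0) (by
    filter_upwards [eventually_ge_atTop R] with L hL
    exact keyhole_eq_zero hq hR hL s)) tendsto_const_nhds
  have hπ := Complex.two_pi_I_ne_zero
  generalize (∫ t in Set.Ioi R, rayTerm q Ψ s t) = X at h3 ⊢
  generalize (∫ θ in (Ψ - 2 * Real.pi)..Ψ, circleTerm q Ψ R s θ) = Y at h3 ⊢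
  generalize 2 * (Real.pi : ℂ) * Complex.I = c at h3 hπ ⊢
  field_simp
  linear_combination h3

/-- For |z| ≥ 2|b| the distance |z - b| is at least |z|/2, so z times the pole term is of order
|z|^p; the outer circle therefore vanishes in the limit as soon as p < Re s. -/
theorem keyhole_pole_Ioi (hΨ : Ψ ∈ Set.Ico (-Real.pi) Real.pi) {b : ℂ}
    (hb : (cutLog Ψ b).im ∈ Set.Ioo (Ψ - 2 * Real.pi) Ψ) (p : ℕ) {R : ℝ} {s : ℂ} (hR : 0 < R)
    (hRb : R < ‖b‖) (hp : p < s.re)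
    (hint : MeasureTheory.IntegrableOn (rayTerm (pole b p) Ψ s) (Set.Ioi R)) :
    rayFactor Ψ s * (∫ t in Set.Ioi R, rayTerm (pole b p) Ψ s t) -
      1 / (2 * (Real.pi : ℂ) * Complex.I) *
        ∫ θ in (Ψ - 2 * Real.pi)..Ψ, circleTerm (pole b p) Ψ R s θ = cutPow Ψ b (-s) := by
  have hb0 : 0 < ‖b‖ := hR.trans hRb
  have hgrow : ∀ᶠ R in atTop, ∀ z : ℂ, ‖z‖ = R →
      R * ‖pole b p z‖ ≤ 2 / ‖b‖ ^ p * R ^ (p : ℝ) := by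
    filter_upwards [eventually_ge_atTop (2 * ‖b‖)] with R hR z hz
    have h0 : 0 < R := lt_of_lt_of_le (by positivity) hR
    have h1 : R / 2 ≤ ‖z - b‖ := by
      have := norm_sub_norm_le z b
      linarith
    rw [pole, norm_div, norm_mul, norm_pow, norm_pow, hz, Real.rpow_natCast]
    calc R * (R ^ p / (‖b‖ ^ p * ‖z - b‖)) ≤ R * (R ^ p / (‖b‖ ^ p * (R / 2))) := by gcongr
      _ = _ := by field_simp
  have h2 := ((((MeasureTheory.intervalIntegral_tendsto_integral_Ioi R hint tendsto_id).const_mul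
    (rayFactor Ψ s)).const_mul (2 * Real.pi * Complex.I)).add
    (tendsto_integral_circleTerm_atTop hΨ hp hgrow)).sub_const
    (∫ θ in (Ψ - 2 * Real.pi)..Ψ, circleTerm (pole b p) Ψ R s θ)
  have h3 := tendsto_nhds_unique (h2.congr'
    (f₂ := fun _ => 2 * Real.pi * Complex.I * cutPow Ψ b (-s)) (by
      filter_upwards [eventually_gt_atTop ‖b‖] with L hL
      exact keyhole_pole hb p hR hRb hL s)) tendsto_const_nhds
  have hπ := Complex.two_pi_I_ne_zero
  generalize (∫ t in Set.Ioi R, rayTerm (pole b p) Ψ s t) = X at h3 ⊢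
  generalize (∫ θ in (Ψ - 2 * Real.pi)..Ψ, circleTerm (pole b p) Ψ R s θ) = Y at h3 ⊢
  generalize 2 * (Real.pi : ℂ) * Complex.I = c at h3 hπ ⊢
  field_simp
  linear_combination h3

/-- Near zero, z times the pole term is of order |z|^(p+1), so the inner circle vanishes in the
limit when Re s < p + 1. -/
theorem ray_pole_Ioi_zero (hΨ : Ψ ∈ Set.Ico (-Real.pi) Real.pi) {b : ℂ} (hb0 : b ≠ 0)
    (hb : (cutLog Ψ b).im ∈ Set.Ioo (Ψ - 2 * Real.pi) Ψ) (p : ℕ) {s : ℂ} (hp : p < s.re)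
    (hp' : s.re < p + 1)
    (hint : MeasureTheory.IntegrableOn (rayTerm (pole b p) Ψ s) (Set.Ioi 0)) :
    rayFactor Ψ s * (∫ t in Set.Ioi (0 : ℝ), rayTerm (pole b p) Ψ s t) = cutPow Ψ b (-s) := by
  have hb1 : 0 < ‖b‖ := norm_pos_iff.2 hb0
  have hgrow : ∀ᶠ R in 𝓝[>] (0 : ℝ), ∀ z : ℂ, ‖z‖ = R →
      R * ‖pole b p z‖ ≤ 2 / (‖b‖ ^ p * ‖b‖) * R ^ ((p : ℝ) + 1) := by
    filter_upwards [Ioc_mem_nhdsGT (half_pos hb1)] with R hR z hz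
    have h0 : 0 < R := hR.1
    have h1 : ‖b‖ / 2 ≤ ‖z - b‖ := by
      have := norm_sub_norm_le b z
      rw [norm_sub_rev] at this
      linarith [hR.2]
    rw [pole, norm_div, norm_mul, norm_pow, norm_pow, hz, Real.rpow_add_one h0.ne',
      Real.rpow_natCast]
    calc R * (R ^ p / (‖b‖ ^ p * ‖z - b‖)) ≤ R * (R ^ p / (‖b‖ ^ p * (‖b‖ / 2))) := by gcongr
      _ = _ := by field_simp
  have hcov := MeasureTheory.aecover_Ioi_of_Ioi (μ := MeasureTheory.volume) (A := (0 : ℝ))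
    (l := 𝓝[>] 0) (a := id) (tendsto_id.mono_left nhdsWithin_le_nhds)
  have h1 := hcov.integral_tendsto_of_countably_generated hint
  have h2 := (h1.const_mul (rayFactor Ψ s)).sub
    ((tendsto_integral_circleTerm_zero hΨ hp' hgrow).const_mul
      (1 / (2 * (Real.pi : ℂ) * Complex.I)))
  have h3 := tendsto_nhds_unique (h2.congr' (f₂ := fun _ => cutPow Ψ b (-s)) (by
    filter_upwards [Ioo_mem_nhdsGT hb1] with R hR
    rw [MeasureTheory.Measure.restrict_restrict measurableSet_Ioi,
      id, Set.inter_eq_left.2 (Set.Ioi_subset_Ioi hR.1.le)]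
    exact keyhole_pole_Ioi hΨ hb p hR.1 hR.2 hp
      (hint.mono_set (Set.Ioi_subset_Ioi hR.1.le)))) tendsto_const_nhds
  rw [mul_zero, sub_zero] at h3
  exact h3

/-! ### Summation over the poles -/

theorem integrableOn_rpow_div_add_one {u : ℝ} (h1 : -1 < u) (h2 : u < 0) :
    MeasureTheory.IntegrableOn (fun t : ℝ => t ^ u / (t + 1)) (Set.Ioi 0) := by
  have hc : ContinuousOn (fun t : ℝ => t ^ u / (t + 1)) (Set.Ioi 0) := by
    intro t ht
    have ht : 0 < t := ht
    exact ((Real.continuousAt_rpow_const t u (Or.inl ht.ne')).div (by fun_prop)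
      (by positivity)).continuousWithinAt
  rw [← Set.Ioc_union_Ioi_eq_Ioi zero_le_one, MeasureTheory.integrableOn_union]
  constructor
  · have := (intervalIntegral.intervalIntegrable_rpow' (a := 0) (b := 1) h1)
    rw [intervalIntegrable_iff_integrableOn_Ioc_of_le zero_le_one] at this
    refine MeasureTheory.Integrable.mono' this
      ((hc.mono Set.Ioc_subset_Ioi_self).aestronglyMeasurable measurableSet_Ioc) ?_
    refine MeasureTheory.ae_restrict_of_forall_mem measurableSet_Ioc fun t ht => ?_
    have h0 := ht.1
    rw [Real.norm_of_nonneg (by positivity)]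
    exact div_le_self (by positivity) (by linarith)
  · refine MeasureTheory.Integrable.mono'
      (integrableOn_Ioi_rpow_of_lt (by linarith : u - 1 < -1) one_pos)
      ((hc.mono (Set.Ioi_subset_Ioi zero_le_one)).aestronglyMeasurable measurableSet_Ioi) ?_
    refine MeasureTheory.ae_restrict_of_forall_mem measurableSet_Ioi fun t ht => ?_
    have h0 : 0 < t := one_pos.trans ht
    rw [Real.norm_of_nonneg (by positivity), Real.rpow_sub_one h0.ne']
    gcongr
    linarith

/-- Substituting t → rt extracts the exact power of r. With u = p - σ and r = |a_n|, combined with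
the factor |a_n|^(-p) of the pole term, it gives the summable |a_n|^(-σ). -/
theorem integrableOn_rpow_div_add {u r : ℝ} (h1 : -1 < u) (h2 : u < 0) (hr : 0 < r) :
    MeasureTheory.IntegrableOn (fun t : ℝ => t ^ u / (t + r)) (Set.Ioi 0) ∧
      ∫ t in Set.Ioi (0 : ℝ), t ^ u / (t + r) =
        r ^ u * ∫ t in Set.Ioi (0 : ℝ), t ^ u / (t + 1) := by
  have e : ∀ t ∈ Set.Ioi (0 : ℝ), (r * t) ^ u / (r * t + r) = r ^ u * r⁻¹ * (t ^ u / (t + 1)) := by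
    intro t ht
    have ht : 0 < t := ht
    rw [Real.mul_rpow hr.le ht.le]
    field_simp
  constructor
  · have := MeasureTheory.integrableOn_Ioi_comp_mul_left_iff (fun t : ℝ => t ^ u / (t + r)) 0 hr
    rw [mul_zero] at this
    rw [← this]
    exact MeasureTheory.IntegrableOn.congr_fun
      ((integrableOn_rpow_div_add_one h1 h2).const_mul (r ^ u * r⁻¹))
      (fun t ht => (e t ht).symm) measurableSet_Ioi
  · have := MeasureTheory.integral_comp_mul_left_Ioi (fun t : ℝ => t ^ u / (t + r)) 0 hr
    rw [mul_zero, MeasureTheory.setIntegral_congr_fun measurableSet_Ioi e,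
      MeasureTheory.integral_const_mul, smul_eq_mul] at this
    field_simp at this
    rw [this]

/-- Tonelli bounds the integral of the sum of the norms. Pointwise summability makes the sum an a.e.
limit of partial sums, hence measurable, and dominated by the sum of the norms. -/
theorem integrable_tsum_of_summable_integral_norm {X : Type*} [MeasurableSpace X]
    {μ : MeasureTheory.Measure X} {F : ℕ → X → ℂ} (hF : ∀ n, MeasureTheory.Integrable (F n) μ)
    (hsum : Summable fun n => ∫ x, ‖F n x‖ ∂μ) (hp : ∀ᵐ x ∂μ, Summable fun n => ‖F n x‖) :
    MeasureTheory.Integrable (fun x => ∑' n, F n x) μ := by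
  constructor
  · refine aestronglyMeasurable_of_tendsto_ae atTop (f := fun N x => ∑ n ∈ Finset.range N, F n x)
      (fun N => ?_) ?_
    · exact Finset.aestronglyMeasurable_fun_sum _ fun n _ => (hF n).1
    · filter_upwards [hp] with x hx
      exact hx.of_norm.hasSum.tendsto_sum_nat
  · have h1 : ∫⁻ x, ∑' n, ‖F n x‖ₑ ∂μ < ⊤ := by
      rw [MeasureTheory.lintegral_tsum fun n => (hF n).1.enorm]
      have : ∀ n, ∫⁻ x, ‖F n x‖ₑ ∂μ = ENNReal.ofReal (∫ x, ‖F n x‖ ∂μ) := fun n =>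
        (MeasureTheory.ofReal_integral_norm_eq_lintegral_enorm (hF n)).symm
      simp only [this]
      rw [← ENNReal.ofReal_tsum_of_nonneg (fun n => by positivity) hsum]
      exact ENNReal.ofReal_lt_top
    refine lt_of_le_of_lt (MeasureTheory.lintegral_mono_ae ?_) h1
    filter_upwards [hp] with x hx
    rw [← ofReal_norm]
    refine (ENNReal.ofReal_le_ofReal (norm_tsum_le_tsum_norm hx)).trans_eq ?_
    rw [ENNReal.ofReal_tsum_of_nonneg (fun n => norm_nonneg _) hx]
    simp only [ofReal_norm]

/-- The sum `∑ z ^ p / (a_n ^ p (z - a_n))`. -/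
def poleSum (a : ℕ → ℂ) (p : ℕ) (z : ℂ) : ℂ := ∑' n, pole (a n) p z

/-- On the half-open interval the integrand agrees with a continuous function; the branch of the
power jumps only at the omitted endpoint. -/
theorem circleTerm_intervalIntegrable {q : ℂ → ℂ} {R : ℝ} (hR : 0 < R)
    (hq : ContinuousOn q (Metric.sphere 0 R)) (s : ℂ) :
    IntervalIntegrable (circleTerm q Ψ R s) MeasureTheory.volume (Ψ - 2 * Real.pi) Ψ := by
  have hle : Ψ - 2 * Real.pi ≤ Ψ := by linarith [Real.pi_pos]
  have hc : Continuous fun θ : ℝ =>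
      Complex.I * logTerm q s (((Real.log R : ℝ) : ℂ) + θ * Complex.I) := by
    unfold logTerm
    simp only [exp_log_add_mul_I hR]
    have : Continuous fun θ => q (circleMap 0 R θ) :=
      hq.comp_continuous (continuous_circleMap 0 R) fun θ => circleMap_mem_sphere 0 hR.le θ
    exact continuous_const.mul
      (Continuous.mul (by fun_prop) (this.mul (continuous_circleMap 0 R)))
  rw [intervalIntegrable_iff_integrableOn_Ioc_of_le hle]
  exact MeasureTheory.IntegrableOn.congr_fun (hc.integrableOn_Ioc)
    (fun θ hθ => (circleTerm_eq_logTerm q hR s hθ).symm) measurableSet_Ioc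

/-- Since ⌊α⌋ + 1 > α, this is the majorant that makes the pole series and the Hadamard product
converge on compact sets. -/
theorem summable_pow_succ (ha : IsZetaSequence a α Ψ) :
    Summable fun n => (‖a n‖ ^ (⌊α⌋₊ + 1))⁻¹ := by
  have h := ha.summable_rpow (Nat.lt_floor_add_one α)
  refine h.congr fun n => ?_
  rw [Real.rpow_neg (norm_nonneg _)]
  exact_mod_cast rfl

theorem norm_pole_le_of_norm_le {b z : ℂ} {r δ : ℝ} (hb : b ≠ 0) (hδ : 0 < δ)
    (h : δ * ‖b‖ ≤ ‖z - b‖) (hz : ‖z‖ ≤ r) (p : ℕ) :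
    ‖pole b p z‖ ≤ r ^ p / δ * (‖b‖ ^ (p + 1))⁻¹ := by
  have hb0 := norm_pos_iff.2 hb
  have hr := (norm_nonneg z).trans hz
  rw [pole, norm_div, norm_mul, norm_pow, norm_pow]
  calc ‖z‖ ^ p / (‖b‖ ^ p * ‖z - b‖) ≤ r ^ p / (‖b‖ ^ p * (δ * ‖b‖)) := by gcongr
    _ = _ := by rw [pow_succ]; field_simp

theorem summable_norm_pole_ray (ha : IsZetaSequence a α Ψ) {t : ℝ} (ht : 0 ≤ t) :
    Summable fun n => ‖pole (a n) ⌊α⌋₊ (t * Complex.exp (Ψ * Complex.I))‖ := by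
  obtain ⟨c, hc, hcb⟩ := ha.exists_sector_bound
  refine Summable.of_nonneg_of_le (fun _ => norm_nonneg _) (fun n => ?_)
    ((summable_pow_succ ha).mul_left (t ^ ⌊α⌋₊ / c))
  refine norm_pole_le_of_norm_le (ha.ne_zero n) hc (le_trans ?_ (hcb n t ht)) ?_ _
  · gcongr; linarith
  · rw [norm_mul, Complex.norm_exp_ofReal_mul_I, mul_one, Complex.norm_real,
      Real.norm_of_nonneg ht]

theorem norm_circle_pole_le (ha : IsZetaSequence a α Ψ) {R : ℝ} (hR : 0 < R) (hRa : R < ‖a 0‖)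
    (n : ℕ) (p : ℕ) {z : ℂ} (hz : ‖z‖ ≤ R) :
    ‖pole (a n) p z‖ ≤ R ^ p / (1 - R / ‖a 0‖) * (‖a n‖ ^ (p + 1))⁻¹ := by
  have h0 := ha.norm_pos
  refine norm_pole_le_of_norm_le (ha.ne_zero n)
    (sub_pos.2 ((div_lt_one h0).2 hRa)) ?_ hz p
  have h1 : ‖a 0‖ ≤ ‖a n‖ := ha.norm_mono (Nat.zero_le n)
  have h2 : R ≤ R / ‖a 0‖ * ‖a n‖ := by
    rw [div_mul_eq_mul_div, le_div_iff₀ h0]; gcongr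
  have h3 := norm_sub_norm_le (a n) z
  rw [norm_sub_rev] at h3
  linarith

/-- Integrability along the ray of the terms and of the sum, on a part of the ray on which
`t ^ (-Re s)` is dominated by `t ^ (-σ)` for some `σ` slightly above the exponent. -/
theorem ray_hasSum (ha : IsZetaSequence a α Ψ) {s : ℂ} {σ K : ℝ} (hσ : α < σ)
    (hσ' : σ < ⌊α⌋₊ + 1) {S : Set ℝ} (hS : MeasurableSet S) (hS0 : S ⊆ Set.Ioi 0)
    (hK : ∀ t ∈ S, t ^ (-s.re) ≤ K * t ^ (-σ)) :
    (∀ n, MeasureTheory.IntegrableOn (rayTerm (pole (a n) ⌊α⌋₊) Ψ s) S) ∧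
    MeasureTheory.IntegrableOn (rayTerm (poleSum a ⌊α⌋₊) Ψ s) S ∧
    HasSum (fun n => ∫ t in S, rayTerm (pole (a n) ⌊α⌋₊) Ψ s t)
      (∫ t in S, rayTerm (poleSum a ⌊α⌋₊) Ψ s t) := by
  set p := ⌊α⌋₊ with hp
  have hpα : (p : ℝ) ≤ α := Nat.floor_le ha.exponent_nonneg
  obtain ⟨c, hc, hcb⟩ := ha.exists_sector_bound
  have hu1 : -1 < (p : ℝ) - σ := by linarith
  have hu2 : (p : ℝ) - σ < 0 := by linarith
  set J := ∫ t in Set.Ioi (0 : ℝ), t ^ ((p : ℝ) - σ) / (t + 1)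
  -- The sector bound replaces |t e^(iΨ) - a_n| by c (t + |a_n|), leaving an integrand whose
  -- integral is known by scaling.
  have hbound : ∀ n, ∀ t ∈ S, ‖rayTerm (pole (a n) p) Ψ s t‖ ≤
      K * c⁻¹ * (‖a n‖ ^ p)⁻¹ * (t ^ ((p : ℝ) - σ) / (t + ‖a n‖)) := by
    intro n t ht
    have ht0 : 0 < t := hS0 ht
    have hb0 := ha.norm_pos' n
    have h1 := hcb n t ht0.le
    rw [rayTerm, norm_mul, norm_mul, Complex.norm_exp_ofReal_mul_I, one_mul,
      Complex.norm_cpow_eq_rpow_re_of_pos ht0, Complex.neg_re, pole, norm_div, norm_mul, norm_pow,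
      norm_pow, norm_mul, Complex.norm_exp_ofReal_mul_I, mul_one, Complex.norm_real,
      Real.norm_of_nonneg ht0.le]
    have hK' := hK t ht
    have hK0 : 0 ≤ K * t ^ (-σ) := le_trans (by positivity) hK'
    calc t ^ (-s.re) * (t ^ p / (‖a n‖ ^ p * ‖t * Complex.exp (Ψ * Complex.I) - a n‖))
        ≤ K * t ^ (-σ) * (t ^ p / (‖a n‖ ^ p * (c * (t + ‖a n‖)))) := by gcongr
      _ = _ := by
        rw [show (p : ℝ) - σ = -σ + p by ring, Real.rpow_add ht0, Real.rpow_natCast]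
        field_simp
  have hint0 : ∀ (C : ℝ) n, MeasureTheory.IntegrableOn
      (fun t => C * (t ^ ((p : ℝ) - σ) / (t + ‖a n‖))) (Set.Ioi 0) :=
    fun C n => (integrableOn_rpow_div_add hu1 hu2 (ha.norm_pos' n)).1.const_mul _
  have hint : ∀ n, MeasureTheory.IntegrableOn (rayTerm (pole (a n) p) Ψ s) S := by
    intro n
    refine MeasureTheory.Integrable.mono' ((hint0 _ n).mono_set hS0) ?_
      (MeasureTheory.ae_restrict_of_forall_mem hS (hbound n))
    refine ContinuousOn.aestronglyMeasurable (ContinuousOn.mono (fun t ht => ?_) hS0) hS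
    have ht0 : 0 < t := ht
    unfold rayTerm pole
    have h1 := Complex.continuousAt_ofReal_cpow_const t (-s) (Or.inr ht0.ne')
    have h2 := sub_ne_zero.2 (ha.ray_ne n ht0.le)
    have h3 := pow_ne_zero p (ha.ne_zero n)
    refine (h1.mul (ContinuousAt.mul (by fun_prop) (ContinuousAt.div (by fun_prop)
      (by fun_prop) (mul_ne_zero h3 h2)))).continuousWithinAt
  have hsum : Summable fun n => ∫ t in S, ‖rayTerm (pole (a n) p) Ψ s t‖ := by
    refine Summable.of_nonneg_of_le (fun n => by positivity) (fun n => ?_)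
      ((ha.summable_rpow hσ).mul_left (|K| * c⁻¹ * J))
    have hb0 := ha.norm_pos' n
    calc ∫ t in S, ‖rayTerm (pole (a n) p) Ψ s t‖
        ≤ ∫ t in S, |K| * c⁻¹ * (‖a n‖ ^ p)⁻¹ * (t ^ ((p : ℝ) - σ) / (t + ‖a n‖)) := by
          refine MeasureTheory.setIntegral_mono_on (hint n).norm
            ((hint0 _ n).mono_set hS0)
            hS fun t ht => (hbound n t ht).trans ?_
          have ht0 : 0 < t := hS0 ht
          gcongr
          exact le_abs_self K
      _ ≤ ∫ t in Set.Ioi 0, |K| * c⁻¹ * (‖a n‖ ^ p)⁻¹ * (t ^ ((p : ℝ) - σ) / (t + ‖a n‖)) := by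
          refine MeasureTheory.setIntegral_mono_set (hint0 _ n) ?_
            hS0.eventuallyLE
          refine MeasureTheory.ae_restrict_of_forall_mem measurableSet_Ioi fun t ht => ?_
          have ht0 : 0 < t := ht
          simp only [Pi.zero_apply]
          positivity
      _ = _ := by
          rw [MeasureTheory.integral_const_mul,
            (integrableOn_rpow_div_add hu1 hu2 (ha.norm_pos' n)).2,
            show (p : ℝ) - σ = p + -σ by ring, Real.rpow_add hb0, Real.rpow_natCast,
            show (p : ℝ) + -σ = p - σ by ring]
          field_simp
          rfl
  have heq : rayTerm (poleSum a p) Ψ s = fun t => ∑' n, rayTerm (pole (a n) p) Ψ s t := by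
    ext t
    simp only [rayTerm, poleSum, tsum_mul_left]
  refine ⟨hint, ?_, ?_⟩
  · rw [heq]
    refine integrable_tsum_of_summable_integral_norm hint hsum
      (MeasureTheory.ae_restrict_of_forall_mem hS fun t ht => ?_)
    simp only [rayTerm, norm_mul]
    exact ((summable_norm_pole_ray ha (le_of_lt (hS0 ht))).mul_left _).mul_left _
  · rw [heq]
    exact MeasureTheory.hasSum_integral_of_summable_integral_norm hint hsum

theorem circle_hasSum (ha : IsZetaSequence a α Ψ) (s : ℂ) {R : ℝ} (hR : 0 < R)
    (hRa : R < ‖a 0‖) :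
    IntervalIntegrable (circleTerm (poleSum a ⌊α⌋₊) Ψ R s) MeasureTheory.volume
      (Ψ - 2 * Real.pi) Ψ ∧
    HasSum (fun n => ∫ θ in (Ψ - 2 * Real.pi)..Ψ, circleTerm (pole (a n) ⌊α⌋₊) Ψ R s θ)
      (∫ θ in (Ψ - 2 * Real.pi)..Ψ, circleTerm (poleSum a ⌊α⌋₊) Ψ R s θ) := by
  set p := ⌊α⌋₊ with hp
  have hle : Ψ - 2 * Real.pi ≤ Ψ := by linarith [Real.pi_pos]
  set M := Real.exp (3 * Real.pi * |s.im|) * R ^ (-s.re) with hM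
  set D := R * (R ^ p / (1 - R / ‖a 0‖)) with hD
  have hbound : ∀ n θ, ‖circleTerm (pole (a n) p) Ψ R s θ‖ ≤ M * D * (‖a n‖ ^ (p + 1))⁻¹ := by
    intro n θ
    refine (norm_circleTerm_le ha.direction hR s (B := D * (‖a n‖ ^ (p + 1))⁻¹)
      (fun z hz => ?_) θ).trans_eq (by rw [mul_assoc M])
    rw [hD, mul_assoc]
    exact mul_le_mul_of_nonneg_left (norm_circle_pole_le ha hR hRa n p hz.le) hR.le
  have hint : ∀ n, MeasureTheory.IntegrableOn (circleTerm (pole (a n) p) Ψ R s)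
      (Set.Ioc (Ψ - 2 * Real.pi) Ψ) := by
    intro n
    rw [← intervalIntegrable_iff_integrableOn_Ioc_of_le hle]
    refine circleTerm_intervalIntegrable hR ?_ s
    unfold pole
    refine ContinuousOn.div (by fun_prop) (by fun_prop) fun z hz =>
      mul_ne_zero (pow_ne_zero _ (ha.ne_zero n)) (sub_ne_zero.2 ?_)
    rintro rfl
    have h1 : ‖a 0‖ ≤ ‖a n‖ := ha.norm_mono (Nat.zero_le n)
    rw [mem_sphere_zero_iff_norm] at hz
    linarith
  have hs1 : Summable fun n => M * D * (‖a n‖ ^ (p + 1))⁻¹ := (summable_pow_succ ha).mul_left _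
  have hsum : Summable fun n =>
      ∫ θ in Set.Ioc (Ψ - 2 * Real.pi) Ψ, ‖circleTerm (pole (a n) p) Ψ R s θ‖ := by
    refine Summable.of_nonneg_of_le (fun n => by positivity) (fun n => ?_)
      (hs1.mul_left (2 * Real.pi))
    refine (MeasureTheory.setIntegral_mono_on (hint n).norm
      (MeasureTheory.integrableOn_const (C := M * D * (‖a n‖ ^ (p + 1))⁻¹) measure_Ioc_lt_top.ne)
      measurableSet_Ioc fun θ _ => hbound n θ).trans_eq ?_
    simp [Real.pi_pos.le]
  have heq : circleTerm (poleSum a p) Ψ R s = fun θ => ∑' n, circleTerm (pole (a n) p) Ψ R s θ := by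
    ext t
    simp only [circleTerm, poleSum, tsum_mul_left]
  simp only [intervalIntegral.integral_of_le hle, intervalIntegrable_iff_integrableOn_Ioc_of_le hle,
    heq]
  exact ⟨integrable_tsum_of_summable_integral_norm hint hsum (.of_forall fun θ =>
    Summable.of_nonneg_of_le (fun _ => norm_nonneg _) (fun n => hbound n θ) hs1),
    MeasureTheory.hasSum_integral_of_summable_integral_norm hint hsum⟩

/-- The representation of the zeta function by the sum over the poles on the whole ray. -/
theorem zeta_eq_ray_poleSum (ha : IsZetaSequence a α Ψ) {s : ℂ} (hs : α < s.re)
    (hs' : s.re < ⌊α⌋₊ + 1) :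
    MeasureTheory.IntegrableOn (rayTerm (poleSum a ⌊α⌋₊) Ψ s) (Set.Ioi 0) ∧
    zeta a Ψ s = rayFactor Ψ s * ∫ t in Set.Ioi (0 : ℝ), rayTerm (poleSum a ⌊α⌋₊) Ψ s t := by
  obtain ⟨h1, h2, h3⟩ := ray_hasSum ha (s := s) (K := 1) hs hs' measurableSet_Ioi subset_rfl
    (fun t _ => (one_mul _).ge)
  refine ⟨h2, ?_⟩
  rw [← (h3.mul_left (rayFactor Ψ s)).tsum_eq, zeta]
  exact tsum_congr fun n => (ray_pole_Ioi_zero ha.direction (ha.ne_zero n) (ha.cutLog_im_mem n) _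
    ((Nat.floor_le ha.exponent_nonneg).trans_lt hs) hs' (h1 n)).symm

/-- The representation of the zeta function by the sum over the poles on a ray and a circle. -/
theorem zeta_eq_keyhole_poleSum (ha : IsZetaSequence a α Ψ) {s : ℂ} {R : ℝ} (hR : 0 < R)
    (hRa : R < ‖a 0‖) (hs : α < s.re) :
    MeasureTheory.IntegrableOn (rayTerm (poleSum a ⌊α⌋₊) Ψ s) (Set.Ioi R) ∧
    IntervalIntegrable (circleTerm (poleSum a ⌊α⌋₊) Ψ R s) MeasureTheory.volume
      (Ψ - 2 * Real.pi) Ψ ∧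
    zeta a Ψ s = rayFactor Ψ s * (∫ t in Set.Ioi R, rayTerm (poleSum a ⌊α⌋₊) Ψ s t) -
      1 / (2 * (Real.pi : ℂ) * Complex.I) *
        ∫ θ in (Ψ - 2 * Real.pi)..Ψ, circleTerm (poleSum a ⌊α⌋₊) Ψ R s θ := by
  -- Re s may be at least p + 1, where the integral from zero would diverge. Away from zero the
  -- exponent can be lowered to some σ < p + 1, since t^(σ - Re s) ≤ R^(σ - Re s) for t ≥ R.
  obtain ⟨σ, hσ1, hσ2⟩ := exists_between (lt_min hs (Nat.lt_floor_add_one α))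
  obtain ⟨h1, h2, h3⟩ := ray_hasSum ha (s := s) (K := R ^ (σ - s.re)) hσ1
    (hσ2.trans_le (min_le_right _ _)) (S := Set.Ioi R) measurableSet_Ioi
    (Set.Ioi_subset_Ioi hR.le) (fun t ht => by
      have ht0 : 0 < t := hR.trans ht
      rw [show -s.re = (σ - s.re) + -σ by ring, Real.rpow_add ht0]
      have h0 : σ - s.re ≤ 0 := by linarith [hσ2.trans_le (min_le_left s.re (⌊α⌋₊ + 1))]
      exact mul_le_mul_of_nonneg_right (Real.rpow_le_rpow_of_nonpos hR (le_of_lt ht) h0)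
        (by positivity))
  obtain ⟨h4, h5⟩ := circle_hasSum ha s hR hRa
  refine ⟨h2, h4, ?_⟩
  rw [← ((h3.mul_left (rayFactor Ψ s)).sub
    (h5.mul_left (1 / (2 * (Real.pi : ℂ) * Complex.I)))).tsum_eq, zeta]
  exact tsum_congr fun n => (keyhole_pole_Ioi ha.direction (ha.cutLog_im_mem n) _ hR
    (hRa.trans_le (ha.norm_mono (Nat.zero_le n)))
    ((Nat.floor_le ha.exponent_nonneg).trans_lt hs) (h1 n)).symm

/-! ### Elementary factors and the Hadamard product -/

theorem pole_eq_inv_add_sum {b z : ℂ} (hb : b ≠ 0) (hz : z - b ≠ 0) (p : ℕ) :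
    pole b p z = (z - b)⁻¹ + ∑ j ∈ Finset.range p, z ^ j / b ^ (j + 1) := by
  induction p with
  | zero => simp [pole]
  | succ p ih =>
    rw [Finset.sum_range_succ, ← add_assoc, ← ih, pole, pole]
    field_simp
    ring

/-- The exponential in the elementary factor cancels the Taylor polynomial of log(1 - u) of degree
p, so w is the remainder of that series, of order |u|^(p+1). -/
theorem elementaryFactor_eq_exp {u : ℂ} (hu : ‖u‖ ≤ 1 / 2) (p : ℕ) :
    ∃ w : ℂ, elementaryFactor u p = Complex.exp w ∧ ‖w‖ ≤ 2 * ‖u‖ ^ (p + 1) := by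
  have hlt : ‖-u‖ < 1 := by rw [norm_neg]; linarith
  refine ⟨Complex.log (1 + -u) - Complex.logTaylor (p + 1) (-u), ?_, ?_⟩
  · have h1 : 1 + -u ≠ 0 := by
      intro h
      have : u = 1 := by linear_combination -h
      rw [this] at hu
      norm_num at hu
    rw [sub_eq_add_neg, Complex.exp_add, Complex.exp_log h1, elementaryFactor, ← sub_eq_add_neg]
    congr 2
    rw [Complex.logTaylor, Finset.sum_range_succ']
    simp only [Nat.cast_zero, div_zero, add_zero]
    rw [← Finset.sum_neg_distrib, Finset.range_eq_Ico, Finset.sum_Ico_add' (fun j : ℕ =>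
      -((-1) ^ (j + 1) * (-u) ^ j / (j : ℂ))) 0 p 1]
    refine Finset.sum_congr (by ext; simp) fun j _ => ?_
    rw [neg_pow u]
    have : (-1 : ℂ) ^ (j + 1) * (-1) ^ j = -1 := by
      rw [← pow_add, show j + 1 + j = 2 * j + 1 by ring, pow_succ, pow_mul]; simp
    rw [← mul_assoc, this]
    ring
  · refine (Complex.norm_log_sub_logTaylor_le p hlt).trans ?_
    rw [norm_neg] at hlt ⊢
    have h2 : (1 - ‖u‖)⁻¹ ≤ 2 := by
      rw [inv_le_comm₀ (by linarith) two_pos]; linarith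
    calc ‖u‖ ^ (p + 1) * (1 - ‖u‖)⁻¹ / (p + 1) ≤ ‖u‖ ^ (p + 1) * (1 - ‖u‖)⁻¹ := by
          refine div_le_self ?_ (by linarith [p.cast_nonneg (α := ℝ)])
          have : 0 ≤ (1 - ‖u‖)⁻¹ := inv_nonneg.2 (by linarith)
          positivity
      _ ≤ ‖u‖ ^ (p + 1) * 2 := by gcongr
      _ = _ := mul_comm _ _

theorem norm_elementaryFactor_sub_one_le {u : ℂ} (hu : ‖u‖ ≤ 1 / 2) (p : ℕ) :
    ‖elementaryFactor u p - 1‖ ≤ 4 * ‖u‖ ^ (p + 1) := by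
  obtain ⟨w, hw, hn⟩ := elementaryFactor_eq_exp hu p
  have h1 : ‖u‖ ^ (p + 1) ≤ 1 / 2 := by
    rw [pow_succ]
    have := pow_le_one₀ (n := p) (norm_nonneg u) (by linarith)
    nlinarith [norm_nonneg u]
  rw [hw]
  refine (Complex.norm_exp_sub_one_le (by linarith)).trans (by linarith)

/-- For |u| ≤ 1/2 the remainder of the logarithm is at most 2|u|^(p+1) ≤ 2|u|^τ. For |u| ≥ 1/2, |1 -
u| ≤ 4|u| gives log|1 - u| ≤ (4|u|)^τ/τ, and each of the p terms in the exponent is at most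
(2|u|)^τ. The three summands of the constant come from these bounds. -/
theorem norm_elementaryFactor_le {τ : ℝ} (p : ℕ) (hτ : 0 < τ) (h1 : p ≤ τ) (h2 : τ ≤ p + 1)
    (u : ℂ) :
    ‖elementaryFactor u p‖ ≤ Real.exp ((2 + 4 ^ τ / τ + p * 2 ^ τ) * ‖u‖ ^ τ) := by
  rcases le_total ‖u‖ (1 / 2) with hu | hu
  · obtain ⟨w, hw, hn⟩ := elementaryFactor_eq_exp hu p
    rw [hw]
    refine (Complex.norm_exp_le_exp_norm w).trans (Real.exp_le_exp.2 (hn.trans ?_))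
    rcases (norm_nonneg u).eq_or_lt with h0 | h0
    · rw [← h0, Real.zero_rpow hτ.ne']; simp
    have h3 : ‖u‖ ^ (p + 1) ≤ ‖u‖ ^ τ := by
      rw [← Real.rpow_natCast]
      exact Real.rpow_le_rpow_of_exponent_ge h0 (by linarith) (by exact_mod_cast h2)
    have h4 : 0 ≤ 4 ^ τ / τ + p * 2 ^ τ := by positivity
    nlinarith [Real.rpow_nonneg (norm_nonneg u) τ]
  · set y := 2 * ‖u‖ with hy
    have hy1 : 1 ≤ y := by linarith
    have e1 : ‖1 - u‖ ≤ Real.exp (4 ^ τ / τ * ‖u‖ ^ τ) := by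
      have h3 : ‖1 - u‖ ≤ 2 * y := by
        refine (norm_sub_le _ _).trans ?_
        rw [norm_one]; linarith
      have h4 : Real.log (2 * y) ≤ (2 * y) ^ τ / τ := Real.log_le_rpow_div (by linarith) hτ
      have h5 : (2 * y) ^ τ = 4 ^ τ * ‖u‖ ^ τ := by
        rw [hy, ← mul_assoc, Real.mul_rpow (by norm_num) (norm_nonneg _)]; norm_num
      refine h3.trans ?_
      rw [← Real.exp_log (show 0 < 2 * y by linarith)]
      refine Real.exp_le_exp.2 (h4.trans_eq ?_)
      rw [h5]; ring
    have e2 : ‖∑ j ∈ Finset.Icc 1 p, u ^ j / (j : ℂ)‖ ≤ p * 2 ^ τ * ‖u‖ ^ τ := by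
      refine (norm_sum_le_of_le _ (f := fun j : ℕ => u ^ j / (j : ℂ)) (n := fun _ => y ^ τ)
        fun j hj => ?_).trans_eq ?_
      · obtain ⟨hj1, hjp⟩ := Finset.mem_Icc.1 hj
        rw [norm_div, norm_pow, Complex.norm_natCast]
        have hjpos : (1 : ℝ) ≤ j := by exact_mod_cast hj1
        calc ‖u‖ ^ j / j ≤ ‖u‖ ^ j := div_le_self (by positivity) hjpos
          _ ≤ y ^ j := by gcongr; linarith
          _ = y ^ (j : ℝ) := (Real.rpow_natCast _ _).symm
          _ ≤ y ^ τ := Real.rpow_le_rpow_of_exponent_le hy1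
            (le_trans (by exact_mod_cast hjp) h1)
      · rw [Finset.sum_const, Nat.card_Icc, hy, Real.mul_rpow two_pos.le (norm_nonneg _)]
        simp
        ring
    rw [elementaryFactor, norm_mul]
    calc ‖1 - u‖ * ‖Complex.exp (∑ j ∈ Finset.Icc 1 p, u ^ j / (j : ℂ))‖
        ≤ Real.exp (4 ^ τ / τ * ‖u‖ ^ τ) * Real.exp (p * 2 ^ τ * ‖u‖ ^ τ) := by
          gcongr
          exact (Complex.norm_exp_le_exp_norm _).trans (Real.exp_le_exp.2 e2)
      _ = Real.exp (4 ^ τ / τ * ‖u‖ ^ τ + p * 2 ^ τ * ‖u‖ ^ τ) := (Real.exp_add _ _).symm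
      _ ≤ _ := Real.exp_le_exp.2 (by nlinarith [Real.rpow_nonneg (norm_nonneg u) τ])

theorem IsZetaSequence.eventually_norm_div_le (ha : IsZetaSequence a α Ψ) (r : ℝ) :
    ∀ᶠ n in atTop, ∀ z : ℂ, ‖z‖ ≤ r →
      ‖z / a n‖ ≤ 1 / 2 ∧ ‖z / a n‖ ^ (⌊α⌋₊ + 1) ≤ r ^ (⌊α⌋₊ + 1) * (‖a n‖ ^ (⌊α⌋₊ + 1))⁻¹ ∧
        ‖pole (a n) ⌊α⌋₊ z‖ ≤ r ^ ⌊α⌋₊ / (1 / 2) * (‖a n‖ ^ (⌊α⌋₊ + 1))⁻¹ := by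
  filter_upwards [ha.tendsto_norm.eventually_ge_atTop (2 * r)] with n hn z hz
  have h0 := ha.norm_pos' n
  have h1 : ‖z / a n‖ ≤ 1 / 2 := by
    rw [norm_div, div_le_iff₀ h0]; linarith
  refine ⟨h1, ?_, norm_pole_le_of_norm_le (ha.ne_zero n) (by norm_num) ?_ hz _⟩
  · rw [norm_div, div_pow, div_eq_mul_inv]
    gcongr
  · have := norm_sub_norm_le (a n) z
    rw [norm_sub_rev] at this
    linarith

theorem IsZetaSequence.summable_norm_pole (ha : IsZetaSequence a α Ψ) (z : ℂ) :
    Summable fun n => ‖pole (a n) ⌊α⌋₊ z‖ := by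
  refine Summable.of_norm_bounded_eventually_nat
    ((summable_pow_succ ha).mul_left (‖z‖ ^ ⌊α⌋₊ / (1 / 2))) ?_
  filter_upwards [ha.eventually_norm_div_le ‖z‖] with n hn
  rw [norm_norm]
  exact (hn z le_rfl).2.2

/-- As |a_n| → ∞, the sequence is a proper map from the discrete space ℕ, hence closed. -/
theorem IsZetaSequence.isClosed_range (ha : IsZetaSequence a α Ψ) : IsClosed (Set.range a) := by
  refine (isProperMap_iff_tendsto_cocompact.2 ⟨continuous_of_discreteTopology, ?_⟩).isClosed_range
  rw [cocompact_eq_cofinite, Nat.cofinite_eq_atTop, ← Metric.cobounded_eq_cocompact,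
    ← tendsto_norm_atTop_iff_cobounded]
  exact ha.tendsto_norm

theorem IsZetaSequence.differentiableOn_poleSum (ha : IsZetaSequence a α Ψ) :
    DifferentiableOn ℂ (poleSum a ⌊α⌋₊) (Set.range a)ᶜ := by
  intro z hz
  refine DifferentiableAt.differentiableWithinAt ?_
  set U := (Set.range a)ᶜ ∩ Metric.ball 0 (‖z‖ + 1) with hU
  have hUo : IsOpen U := ha.isClosed_range.isOpen_compl.inter Metric.isOpen_ball
  have hzU : z ∈ U := ⟨hz, by simp⟩
  have hu : TendstoUniformlyOn (fun N x => ∑ n ∈ Finset.range N, pole (a n) ⌊α⌋₊ x)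
      (poleSum a ⌊α⌋₊) atTop U := by
    refine tendstoUniformlyOn_tsum_nat_eventually
      ((summable_pow_succ ha).mul_left ((‖z‖ + 1) ^ ⌊α⌋₊ / (1 / 2))) ?_
    filter_upwards [ha.eventually_norm_div_le (‖z‖ + 1)] with n hn x hx
    exact (hn x (by simpa using (Metric.mem_ball.1 hx.2).le)).2.2
  refine (hu.tendstoLocallyUniformlyOn.differentiableOn (.of_forall fun N => ?_)
    hUo).differentiableAt (hUo.mem_nhds hzU)
  refine DifferentiableOn.fun_sum fun n _ x hx => DifferentiableAt.differentiableWithinAt ?_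
  have h1 := pow_ne_zero ⌊α⌋₊ (ha.ne_zero n)
  have h2 : x - a n ≠ 0 := sub_ne_zero.2 fun h => hx.1 ⟨n, h.symm⟩
  unfold pole
  exact DifferentiableAt.div (by fun_prop) (by fun_prop) (mul_ne_zero h1 h2)

theorem differentiable_elementaryFactor_div (b : ℂ) (p : ℕ) :
    Differentiable ℂ fun z => elementaryFactor (z / b) p := by
  unfold elementaryFactor
  fun_prop

theorem elementaryFactor_div_ne_zero {b z : ℂ} (hb : b ≠ 0) (hz : z ≠ b) (p : ℕ) :
    elementaryFactor (z / b) p ≠ 0 := by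
  refine mul_ne_zero (sub_ne_zero.2 fun h => hz ?_) (Complex.exp_ne_zero _)
  field_simp at h
  exact h.symm

theorem logDeriv_elementaryFactor_div {b z : ℂ} (hb : b ≠ 0) (hz : z ≠ b) (p : ℕ) :
    logDeriv (fun z => elementaryFactor (z / b) p) z = pole b p z := by
  have hzb := sub_ne_zero.2 hz
  have h1 : (1 : ℂ) - z / b ≠ 0 := by
    intro h
    field_simp at h
    exact hzb (by linear_combination -h)
  rw [pole_eq_inv_add_sum hb hzb]
  unfold elementaryFactor
  rw [logDeriv_mul (f := fun z => 1 - z / b)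
    (g := fun z => Complex.exp (∑ j ∈ Finset.Icc 1 p, (z / b) ^ j / (j : ℂ))) z h1
    (Complex.exp_ne_zero _) (by fun_prop) (by fun_prop)]
  congr 1
  · have : HasDerivAt (fun z => 1 - z / b) (-(1 / b)) z :=
      ((hasDerivAt_id z).div_const b).const_sub 1
    rw [logDeriv_apply, this.deriv]
    have h2 : b - z ≠ 0 := sub_ne_zero.2 hz.symm
    field_simp
    ring
  · have hd : HasDerivAt (fun z => ∑ j ∈ Finset.Icc 1 p, (z / b) ^ j / (j : ℂ))
        (∑ j ∈ Finset.range p, z ^ j / b ^ (j + 1)) z := by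
      have e : ∑ j ∈ Finset.range p, z ^ j / b ^ (j + 1) =
          ∑ j ∈ Finset.Icc 1 p, z ^ (j - 1) / b ^ j := by
        rw [Finset.range_eq_Ico]
        exact (Finset.sum_Ico_add' (fun j : ℕ => z ^ (j - 1) / b ^ j) 0 p 1)
      rw [e]
      refine HasDerivAt.fun_sum fun j hj => ?_
      have hj0 : (j : ℂ) ≠ 0 := by
        have := (Finset.mem_Icc.1 hj).1
        exact_mod_cast (by omega : j ≠ 0)
      have := (((hasDerivAt_id z).div_const b).pow j).div_const (j : ℂ)
      refine this.congr_deriv ?_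
      obtain ⟨k, rfl⟩ : ∃ k, j = k + 1 := ⟨j - 1, by have := (Finset.mem_Icc.1 hj).1; omega⟩
      simp only [id, Nat.add_sub_cancel, div_pow, pow_succ]
      field_simp
    rw [logDeriv_apply, hd.cexp.deriv]
    field_simp

theorem IsZetaSequence.multipliable (ha : IsZetaSequence a α Ψ) (r : ℝ) :
    MultipliableLocallyUniformlyOn (fun n z => elementaryFactor (z / a n) ⌊α⌋₊)
      (Metric.ball 0 r) := by
  have h := Summable.multipliableLocallyUniformlyOn_nat_one_add
    (f := fun n z => elementaryFactor (z / a n) ⌊α⌋₊ - 1)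
    (Metric.isOpen_ball (x := (0 : ℂ)) (ε := r))
    ((summable_pow_succ ha).mul_left (4 * r ^ (⌊α⌋₊ + 1))) ?_ ?_
  · simpa only [add_sub_cancel] using h
  · filter_upwards [ha.eventually_norm_div_le r] with n hn z hz
    obtain ⟨h1, h2, -⟩ := hn z (by simpa using (Metric.mem_ball.1 hz).le)
    refine (norm_elementaryFactor_sub_one_le h1 _).trans ?_
    rw [mul_assoc]
    gcongr
  · exact fun n => ((differentiable_elementaryFactor_div _ _).continuous.sub
      continuous_const).continuousOn

theorem IsZetaSequence.hadamard_ne_zero (ha : IsZetaSequence a α Ψ) {z : ℂ}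
    (hz : z ∉ Set.range a) : hadamard a α z ≠ 0 := by
  have h := tprod_one_add_ne_zero_of_summable
    (f := fun n => elementaryFactor (z / a n) ⌊α⌋₊ - 1) ?_ ?_
  · simp only [add_sub_cancel] at h
    exact h
  · intro n
    rw [add_sub_cancel]
    exact elementaryFactor_div_ne_zero (ha.ne_zero n) (fun h => hz ⟨n, h.symm⟩) _
  · refine Summable.of_norm_bounded_eventually_nat
      ((summable_pow_succ ha).mul_left (4 * ‖z‖ ^ (⌊α⌋₊ + 1))) ?_
    filter_upwards [ha.eventually_norm_div_le ‖z‖] with n hn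
    obtain ⟨h1, h2, -⟩ := hn z le_rfl
    rw [norm_norm, mul_assoc]
    refine (norm_elementaryFactor_sub_one_le h1 _).trans ?_
    gcongr

/-- The logarithmic derivative of the Hadamard product. -/
theorem IsZetaSequence.logDeriv_hadamard (ha : IsZetaSequence a α Ψ) {z : ℂ}
    (hz : z ∉ Set.range a) : logDeriv (hadamard a α) z = poleSum a ⌊α⌋₊ z := by
  have hne : ∀ n, z ≠ a n := fun n h => hz ⟨n, h.symm⟩
  have hld : ∀ n, logDeriv (fun z => elementaryFactor (z / a n) ⌊α⌋₊) z = pole (a n) ⌊α⌋₊ z :=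
    fun n => logDeriv_elementaryFactor_div (ha.ne_zero n) (hne n) _
  have := logDeriv_tprod_eq_tsum (s := Metric.ball 0 (‖z‖ + 1)) Metric.isOpen_ball (x := z)
    (by simp) (f := fun n z => elementaryFactor (z / a n) ⌊α⌋₊)
    (fun n => elementaryFactor_div_ne_zero (ha.ne_zero n) (hne n) _)
    (fun n => (differentiable_elementaryFactor_div _ _).differentiableOn)
    (by simpa only [hld] using (ha.summable_norm_pole z).of_norm) (ha.multipliable _)
    (ha.hadamard_ne_zero hz)
  simp only [hld] at this
  exact this

theorem IsZetaSequence.differentiable_hadamard (ha : IsZetaSequence a α Ψ) :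
    Differentiable ℂ (hadamard a α) := by
  intro z
  have h := (ha.multipliable (‖z‖ + 1)).hasProdLocallyUniformlyOn
  have h2 := h.differentiableOn (Filter.Eventually.of_forall fun N => ?_) Metric.isOpen_ball
  · exact h2.differentiableAt (Metric.isOpen_ball.mem_nhds (by simp))
  · exact DifferentiableOn.fun_finsetProd fun n _ =>
      (differentiable_elementaryFactor_div _ _).differentiableOn

theorem IsZetaSequence.norm_hadamard_le (ha : IsZetaSequence a α Ψ) {τ : ℝ} (h1 : α < τ)
    (h2 : τ ≤ ⌊α⌋₊ + 1) : ∃ C : ℝ, ∀ z, ‖hadamard a α z‖ ≤ Real.exp (C * ‖z‖ ^ τ) := by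
  have hτ : 0 < τ := ha.exponent_nonneg.trans_lt h1
  have hpτ : ⌊α⌋₊ ≤ τ := (Nat.floor_le ha.exponent_nonneg).trans h1.le
  have hs := ha.summable_rpow h1
  set K := 2 + 4 ^ τ / τ + ⌊α⌋₊ * 2 ^ τ with hK
  have hK0 : 0 ≤ K := by positivity
  refine ⟨K * ∑' n, ‖a n‖ ^ (-τ), fun z => ?_⟩
  have hm : Multipliable fun n => elementaryFactor (z / a n) ⌊α⌋₊ :=
    (ha.multipliable (‖z‖ + 1)).multipliable (by simp)
  refine le_of_tendsto hm.hasProd.norm (.of_forall fun N => ?_)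
  calc ∏ n ∈ N, ‖elementaryFactor (z / a n) ⌊α⌋₊‖
      ≤ ∏ n ∈ N, Real.exp (K * ‖z‖ ^ τ * ‖a n‖ ^ (-τ)) := by
        refine Finset.prod_le_prod (fun _ _ => norm_nonneg _) fun n _ => ?_
        refine (norm_elementaryFactor_le _ hτ hpτ h2 _).trans_eq ?_
        rw [norm_div, Real.div_rpow (norm_nonneg _) (norm_nonneg _),
          Real.rpow_neg (norm_nonneg _)]
        congr 1
        ring
    _ = Real.exp (K * ‖z‖ ^ τ * ∑ n ∈ N, ‖a n‖ ^ (-τ)) := by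
        rw [← Real.exp_sum, Finset.mul_sum]
    _ ≤ Real.exp (K * (∑' n, ‖a n‖ ^ (-τ)) * ‖z‖ ^ τ) := by
        apply Real.exp_le_exp.2
        have := hs.sum_le_tsum N fun n _ => by positivity
        calc K * ‖z‖ ^ τ * ∑ n ∈ N, ‖a n‖ ^ (-τ) ≤ K * ‖z‖ ^ τ * ∑' n, ‖a n‖ ^ (-τ) := by gcongr
          _ = _ := by ring

/-- With τ strictly between α and min(ρ, p + 1), the product is bounded by exp(C|z|^τ), and C|z|^τ ≤
|z|^ρ for large |z|. -/
theorem IsZetaSequence.growthOrder_hadamard_le (ha : IsZetaSequence a α Ψ) {ρ : NNReal}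
    (h : α < ρ) : growthOrder (hadamard a α) ≤ ρ := by
  refine iInf₂_le_of_le ρ ?_ le_rfl
  obtain ⟨τ, h1, h2⟩ := exists_between (lt_min h (Nat.lt_floor_add_one α))
  obtain ⟨C, hC⟩ := ha.norm_hadamard_le h1 (h2.trans_le (min_le_right _ _)).le
  have hlim : Tendsto (fun z : ℂ => ‖z‖ ^ ((ρ : ℝ) - τ)) (Bornology.cobounded ℂ) atTop :=
    (tendsto_rpow_atTop (sub_pos.2 (h2.trans_le (min_le_left _ _)))).comp
      tendsto_norm_cobounded_atTop
  refine Asymptotics.IsBigO.of_bound 1 ?_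
  filter_upwards [hlim.eventually_ge_atTop C,
    tendsto_norm_cobounded_atTop.eventually_gt_atTop 0] with z hz h0
  rw [one_mul, Real.norm_of_nonneg (Real.exp_nonneg _)]
  refine (hC z).trans (Real.exp_le_exp.2 ?_)
  calc C * ‖z‖ ^ τ ≤ ‖z‖ ^ ((ρ : ℝ) - τ) * ‖z‖ ^ τ := by gcongr
    _ = ‖z‖ ^ (ρ : ℝ) := by rw [← Real.rpow_add h0, sub_add_cancel]

/-- The order of the Hadamard product is at most α < p + 1. This is the only use of the minimality
of the order of F. -/
theorem IsMinimalCharacteristic.exists_isBigO {F : ℂ → ℂ} (ha : IsZetaSequence a α Ψ)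
    (hF : IsMinimalCharacteristic a α F) : ∃ ρ : ℝ, 0 ≤ ρ ∧ ρ < ⌊α⌋₊ + 1 ∧
      F =O[Bornology.cobounded ℂ] fun z => Real.exp (‖z‖ ^ ρ) := by
  obtain ⟨ρ, h1, h2⟩ := exists_between (Nat.lt_floor_add_one α)
  lift ρ to NNReal using ha.exponent_nonneg.trans h1.le
  have h3 : growthOrder F < ((⌊α⌋₊ + 1 : NNReal) : ENNReal) := by
    rw [hF.order]
    refine (ha.growthOrder_hadamard_le h1).trans_lt ?_
    exact_mod_cast h2
  unfold growthOrder at h3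
  obtain ⟨ρ', h4⟩ := iInf_lt_iff.1 h3
  obtain ⟨h5, h6⟩ := iInf_lt_iff.1 h4
  refine ⟨ρ', ρ'.2, ?_, h5⟩
  exact_mod_cast h6

/-! ### Partial fractions of the logarithmic derivative of a function of finite order -/

variable {F : ℂ → ℂ}

/-- Splitting off the first zeros of an entire function. -/
theorem exists_eq_prod_mul (hF : Differentiable ℂ F)
    (hz : ∀ z, analyticOrderAt F z = {n : ℕ | a n = z}.encard) (N : ℕ) :
    ∃ f : ℂ → ℂ, Differentiable ℂ f ∧ (∀ z, F z = (∏ n ∈ Finset.range N, (z - a n)) * f z) ∧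
      ∀ z, analyticOrderAt f z = {n : ℕ | N ≤ n ∧ a n = z}.encard := by
  induction N with
  | zero => exact ⟨F, hF, by simp, by simpa using hz⟩
  | succ N ih =>
    obtain ⟨f, hf, hFf, ho⟩ := ih
    have h0 : f (a N) = 0 := by
      by_contra hne
      have h1 := (hf.analyticAt (a N)).analyticOrderAt_eq_zero.2 hne
      rw [ho, Set.encard_eq_zero] at h1
      have : N ∈ {n : ℕ | N ≤ n ∧ a n = a N} := ⟨le_rfl, rfl⟩
      rw [h1] at this
      exact this
    have hg : Differentiable ℂ (dslope f (a N)) := differentiable_dslope hf _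
    have hfg : ∀ z, f z = (z - a N) * dslope f (a N) z := by
      intro z
      have := sub_smul_dslope f (a N) z
      rw [h0, sub_zero, smul_eq_mul] at this
      exact this.symm
    refine ⟨dslope f (a N), hg, fun z => ?_, fun z => ?_⟩
    · rw [hFf, hfg z, Finset.prod_range_succ, mul_assoc]
    · have h1 : analyticOrderAt f z =
          analyticOrderAt (· - a N) z + analyticOrderAt (dslope f (a N)) z := by
        rw [← analyticOrderAt_mul (by fun_prop) (hg.analyticAt z)]
        congr 1
        exact funext hfg
      rw [ho] at h1
      by_cases hzN : z = a N
      · subst hzN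
        have h2 : {n : ℕ | N ≤ n ∧ a n = a N} = insert N {n : ℕ | N + 1 ≤ n ∧ a n = a N} := by
          ext n
          simp only [Set.mem_ofPred_eq, Set.mem_insert_iff]
          constructor
          · rintro ⟨h, e⟩
            rcases h.eq_or_lt with h | h
            · exact Or.inl h.symm
            · exact Or.inr ⟨h, e⟩
          · rintro (rfl | ⟨h, e⟩)
            · exact ⟨le_rfl, rfl⟩
            · exact ⟨by omega, e⟩
        rw [h2, Set.encard_insert_of_notMem (by simp), analyticOrderAt_id_sub_const_self,
          add_comm] at h1
        exact (ENat.add_right_injective_of_ne_top ENat.one_ne_top h1).symm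
      · rw [analyticOrderAt_id_sub_const_of_ne hzN, zero_add] at h1
        rw [← h1]
        congr 1
        ext n
        simp only [Set.mem_ofPred_eq]
        constructor
        · rintro ⟨h, e⟩
          rcases h.eq_or_lt with h | h
          · subst h; exact absurd e.symm hzN
          · exact ⟨h, e⟩
        · rintro ⟨h, e⟩
          exact ⟨by omega, e⟩

/-- Bound for the derivatives of the logarithm of a zero-free function on a disc. -/
theorem norm_iteratedDeriv_logDeriv_le {f : ℂ → ℂ} (hf : Differentiable ℂ f) {r M : ℝ}
    (hr : 0 < r) (hM : 0 < M) (hne : ∀ z ∈ Metric.ball (0 : ℂ) r, f z ≠ 0)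
    (hb : ∀ z ∈ Metric.ball (0 : ℂ) r, ‖f z‖ ≤ Real.exp M * ‖f 0‖) (k : ℕ) :
    ‖iteratedDeriv k (logDeriv f) 0‖ ≤ (k + 1).factorial * (2 * M) / (r / 2) ^ (k + 1) := by
  have h00 : (0 : ℂ) ∈ Metric.ball (0 : ℂ) r := Metric.mem_ball_self hr
  have hd : DifferentiableOn ℂ (logDeriv f) (Metric.ball 0 r) := by
    intro z hz
    exact ((hf.deriv z).div (hf z) (hne z hz)).differentiableWithinAt
  -- A primitive of f'/f vanishing at 0 is a logarithm of f/f(0). The upper bound on |f| bounds its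
  -- real part, and Borel–Carathéodory turns this into |L| ≤ 2M on the circle of radius r/2, to
  -- which Cauchy's estimate applies.
  obtain ⟨L, hL0, hL⟩ := hd.isExactOn_ball.with_val_at 0 0
  have hLd : DifferentiableOn ℂ L (Metric.ball 0 r) :=
    fun z hz => (hL z hz).differentiableAt.differentiableWithinAt
  have hexp : ∀ z ∈ Metric.ball (0 : ℂ) r, f z = f 0 * Complex.exp (L z) := by
    have hder : ∀ z ∈ Metric.ball (0 : ℂ) r,
        HasDerivAt (fun z => f z * Complex.exp (-L z)) 0 z := by
      intro z hz
      refine ((hf z).hasDerivAt.mul (hL z hz).neg.cexp).congr_deriv ?_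
      rw [logDeriv_apply]
      have := hne z hz
      field_simp
      ring
    intro z hz
    have hconst := (convex_ball (0 : ℂ) r).is_const_of_fderivWithin_eq_zero (𝕜 := ℂ)
      (f := fun z => f z * Complex.exp (-L z))
      (fun z hz => (hder z hz).differentiableAt.differentiableWithinAt) (fun z hz => by
        rw [fderivWithin_of_isOpen Metric.isOpen_ball hz]
        ext
        simp [(hder z hz).deriv]) hz h00
    simp only [hL0, neg_zero, Complex.exp_zero, mul_one] at hconst
    rw [← hconst, mul_assoc, ← Complex.exp_add]
    simp
  have hmaps : Set.MapsTo L (Metric.ball 0 r) {z | z.re ≤ M} := by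
    intro z hz
    have h1 := hb z hz
    rw [hexp z hz, norm_mul, Complex.norm_exp, mul_comm] at h1
    exact Real.exp_le_exp.1 (le_of_mul_le_mul_right h1 (norm_pos_iff.2 (hne 0 h00)))
  have hsub : Metric.closedBall (0 : ℂ) (r / 2) ⊆ Metric.ball 0 r :=
    Metric.closedBall_subset_ball (by linarith)
  have hcauchy := Complex.norm_iteratedDeriv_le_of_forall_mem_sphere_norm_le (c := 0) (f := L)
    (k + 1) (half_pos hr) (C := 2 * M)
    ((hLd.mono hsub).diffContOnCl_ball subset_rfl) (fun z hz => by
      have hzn : ‖z‖ = r / 2 := by simpa using hz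
      have := Complex.borelCaratheodory_zero hM hLd hmaps hr
        (hsub (Metric.sphere_subset_closedBall hz)) hL0
      rw [hzn, sub_half, mul_div_assoc, div_self (half_pos hr).ne', mul_one] at this
      exact this)
  rw [iteratedDeriv_succ', Filter.EventuallyEq.iteratedDeriv_eq k (g := logDeriv f)] at hcauchy
  · exact hcauchy
  · filter_upwards [Metric.isOpen_ball.mem_nhds h00] with z hz
    exact (hL z hz).deriv

theorem iteratedDeriv_sum_pow_zero (c : ℕ → ℂ) {p k : ℕ} (h : p ≤ k) :
    iteratedDeriv k (fun z : ℂ => ∑ j ∈ Finset.range p, c j * z ^ j) 0 = 0 := by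
  rw [iteratedDeriv_fun_sum fun j _ => by fun_prop]
  refine Finset.sum_eq_zero fun j hj => ?_
  rw [iteratedDeriv_const_mul_field, iteratedDeriv_fun_pow_zero, if_neg, Nat.cast_zero, mul_zero]
  have := Finset.mem_range.1 hj
  omega

theorem eq_sum_pow_of_iteratedDeriv_eq_zero {f : ℂ → ℂ} {r : ℝ}
    (hf : DifferentiableOn ℂ f (Metric.ball 0 r)) {p : ℕ}
    (h : ∀ k, p ≤ k → iteratedDeriv k f 0 = 0) :
    ∃ c : ℕ → ℂ, ∀ z ∈ Metric.ball (0 : ℂ) r, f z = ∑ j ∈ Finset.range p, c j * z ^ j := by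
  refine ⟨fun j => (j.factorial : ℂ)⁻¹ * iteratedDeriv j f 0, fun z hz => ?_⟩
  have h1 := Complex.hasSum_taylorSeries_on_ball hf hz
  have h2 := hasSum_sum_of_ne_finset_zero (L := SummationFilter.unconditional ℕ)
    (s := Finset.range p)
    (f := fun n : ℕ => (n.factorial : ℂ)⁻¹ • (z - 0) ^ n • iteratedDeriv n f 0) fun k hk => by
      rw [h k (by simpa using hk)]; simp
  rw [h1.unique h2]
  refine Finset.sum_congr rfl fun j _ => ?_
  simp only [sub_zero, smul_eq_mul]
  ring

/-- On |w| = 3|a_N| each removed factor satisfies |w - a_n| ≥ |a_n|, so |f(w)/f(0)| ≤ |F(w)/F(0)|.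
The maximum principle carries the growth bound of F into the smaller disc, with C independent of N.
-/
theorem IsZetaSequence.exists_norm_ratio_le (ha : IsZetaSequence a α Ψ)
    (hF0 : F 0 ≠ 0) {ρ : ℝ}
    (hO : F =O[Bornology.cobounded ℂ] fun z => Real.exp (‖z‖ ^ ρ)) :
    ∃ C : ℝ, 0 < C ∧ ∀ᶠ N in atTop, ∀ f : ℂ → ℂ, Differentiable ℂ f →
      (∀ z, F z = (∏ n ∈ Finset.range N, (z - a n)) * f z) →
      ∀ z ∈ Metric.ball (0 : ℂ) ‖a N‖, ‖f z‖ ≤ Real.exp (C + 3 ^ ρ * ‖a N‖ ^ ρ) * ‖f 0‖ := by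
  obtain ⟨B, hB⟩ := hO.bound
  rw [(Metric.hasBasis_cobounded_compl_ball (0 : ℂ)).eventually_iff] at hB
  obtain ⟨A, -, hA⟩ := hB
  refine ⟨|Real.log ((|B| + 1) / ‖F 0‖)| + 1, by positivity, ?_⟩
  filter_upwards [ha.tendsto_norm.eventually_ge_atTop A] with N hN f hf hFf z hz
  have hr := ha.norm_pos' N
  set r := ‖a N‖ with hrdef
  have hf0 : 0 < ‖f 0‖ := by
    rw [norm_pos_iff]
    intro h
    rw [hFf, h, mul_zero] at hF0
    exact hF0 rfl
  have hmax := Complex.norm_le_of_forall_mem_frontier_norm_le (U := Metric.ball (0 : ℂ) (3 * r))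
    Metric.isBounded_ball hf.diffContOnCl
    (C := Real.exp (|Real.log ((|B| + 1) / ‖F 0‖)| + 1 + 3 ^ ρ * r ^ ρ) * ‖f 0‖) ?_
    (subset_closure (Metric.ball_subset_ball (by linarith) hz))
  · exact hmax
  intro w hw
  rw [frontier_ball _ (by positivity), mem_sphere_zero_iff_norm] at hw
  have hFw : ‖F w‖ ≤ (|B| + 1) * Real.exp (3 ^ ρ * r ^ ρ) := by
    have := hA (x := w) (by simp [hw]; linarith)
    rw [Real.norm_of_nonneg (Real.exp_nonneg _), hw,
      Real.mul_rpow (by norm_num) hr.le] at this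
    refine this.trans ?_
    gcongr
    linarith [le_abs_self B]
  have hprod : ∏ n ∈ Finset.range N, ‖0 - a n‖ ≤ ∏ n ∈ Finset.range N, ‖w - a n‖ := by
    refine Finset.prod_le_prod (fun _ _ => norm_nonneg _) fun n hn => ?_
    have h1 : ‖a n‖ ≤ r := ha.norm_mono (Finset.mem_range.1 hn).le
    have h2 := norm_sub_norm_le w (a n)
    rw [zero_sub, norm_neg]
    linarith
  have hprod0 : 0 < ∏ n ∈ Finset.range N, ‖0 - a n‖ := by
    refine Finset.prod_pos fun n _ => ?_
    rw [zero_sub, norm_neg]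
    exact ha.norm_pos' n
  have e0 : ‖F 0‖ = (∏ n ∈ Finset.range N, ‖0 - a n‖) * ‖f 0‖ := by
    rw [hFf 0, norm_mul, norm_prod]
  have ew : ‖F w‖ = (∏ n ∈ Finset.range N, ‖w - a n‖) * ‖f w‖ := by
    rw [hFf w, norm_mul, norm_prod]
  have hF0' : 0 < ‖F 0‖ := norm_pos_iff.2 hF0
  have hlog : (|B| + 1) ≤ Real.exp (|Real.log ((|B| + 1) / ‖F 0‖)| + 1) * ‖F 0‖ := by
    rw [← div_le_iff₀ hF0']
    have hpos : 0 < (|B| + 1) / ‖F 0‖ := by positivity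
    calc (|B| + 1) / ‖F 0‖ = Real.exp (Real.log ((|B| + 1) / ‖F 0‖)) := (Real.exp_log hpos).symm
      _ ≤ _ := Real.exp_le_exp.2 (by linarith [le_abs_self (Real.log ((|B| + 1) / ‖F 0‖))])
  set P := ∏ n ∈ Finset.range N, ‖0 - a n‖ with hP
  refine le_of_mul_le_mul_left ?_ hprod0
  calc P * ‖f w‖ ≤ ‖F w‖ := by rw [ew]; gcongr
    _ ≤ (|B| + 1) * Real.exp (3 ^ ρ * r ^ ρ) := hFw
    _ ≤ Real.exp (|Real.log ((|B| + 1) / ‖F 0‖)| + 1) * ‖F 0‖ * Real.exp (3 ^ ρ * r ^ ρ) := by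
        gcongr
    _ = _ := by rw [e0, Real.exp_add _ (3 ^ ρ * r ^ ρ)]; ring

theorem IsMinimalCharacteristic.ne_zero (hF : IsMinimalCharacteristic a α F) {z : ℂ}
    (hz : z ∉ Set.range a) : F z ≠ 0 := by
  rw [← (hF.entire.analyticAt z).analyticOrderAt_eq_zero, hF.zeros, Set.encard_eq_zero]
  exact Set.eq_empty_of_forall_notMem fun n hn => hz ⟨n, hn⟩

theorem IsZetaSequence.ball_subset (ha : IsZetaSequence a α Ψ) {N : ℕ} {z : ℂ}
    (hz : z ∈ Metric.ball (0 : ℂ) ‖a N‖) {n : ℕ} (hn : N ≤ n) : a n ≠ z := by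
  rintro rfl
  have : ‖a N‖ ≤ ‖a n‖ := ha.norm_mono hn
  simp only [mem_ball_zero_iff] at hz
  linarith

theorem tendsto_growth_div_pow {C ρ : ℝ} {k : ℕ} (hρ : ρ < k + 1) :
    Tendsto (fun r : ℝ => (C + 3 ^ ρ * r ^ ρ) / (r / 2) ^ (k + 1)) atTop (𝓝 0) := by
  have h1 := (tendsto_rpow_neg_atTop (y := (k : ℝ) + 1) (by positivity)).const_mul (C * 2 ^ (k + 1))
  have h2 := (tendsto_rpow_neg_atTop (sub_pos.2 hρ)).const_mul (3 ^ ρ * 2 ^ (k + 1))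
  have h3 := h1.add h2
  rw [mul_zero, mul_zero, add_zero] at h3
  refine h3.congr' ?_
  filter_upwards [eventually_gt_atTop 0] with r hr
  rw [show -((k : ℝ) + 1 - ρ) = ρ + -((k : ℝ) + 1) by ring, Real.rpow_add hr,
    Real.rpow_neg hr.le, show (k : ℝ) + 1 = ((k + 1 : ℕ) : ℝ) by push_cast; ring,
    Real.rpow_natCast, div_pow]
  field_simp

/-- The partial fraction expansion of the logarithmic derivative of an entire function of finite
order. -/
theorem IsMinimalCharacteristic.exists_logDeriv_eq (ha : IsZetaSequence a α Ψ)
    (hF : IsMinimalCharacteristic a α F) :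
    ∃ c : ℕ → ℂ, ∀ z ∉ Set.range a,
      logDeriv F z = (∑ j ∈ Finset.range ⌊α⌋₊, c j * z ^ j) + poleSum a ⌊α⌋₊ z := by
  set p := ⌊α⌋₊ with hp
  set V := (Set.range a)ᶜ with hV
  have hVo : IsOpen V := ha.isClosed_range.isOpen_compl
  have hball : Metric.ball (0 : ℂ) ‖a 0‖ ⊆ V := fun z hz ⟨n, hn⟩ =>
    ha.ball_subset hz (Nat.zero_le n) hn
  have h00 : (0 : ℂ) ∈ Metric.ball (0 : ℂ) ‖a 0‖ := Metric.mem_ball_self ha.norm_pos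
  have hlF : DifferentiableOn ℂ (logDeriv F) V := fun z hz =>
    ((hF.entire.deriv z).div (hF.entire z) (hF.ne_zero hz)).differentiableWithinAt
  have hG : DifferentiableOn ℂ (poleSum a p) V := ha.differentiableOn_poleSum
  have hpole : ∀ n, DifferentiableOn ℂ (pole (a n) p) V := fun n z hz => by
    have h1 := pow_ne_zero p (ha.ne_zero n)
    have h2 : z - a n ≠ 0 := sub_ne_zero.2 fun h => hz ⟨n, h.symm⟩
    unfold pole
    refine DifferentiableAt.differentiableWithinAt ?_
    exact DifferentiableAt.div (by fun_prop) (by fun_prop) (mul_ne_zero h1 h2)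
  set D : ℂ → ℂ := fun z => logDeriv F z - poleSum a p z with hD
  have hDd : DifferentiableOn ℂ D V := hlF.sub hG
  obtain ⟨ρ, -, hρ1, hO⟩ := hF.exists_isBigO ha
  have hF0 : F 0 ≠ 0 := hF.ne_zero (hball h00)
  obtain ⟨C, hC0, hC⟩ := ha.exists_norm_ratio_le hF0 hO
  -- Near 0 and for each N, D is the logarithmic derivative of F with N zeros removed, minus the
  -- tail T of the pole series, minus a polynomial Q of degree less than p. The k-th derivative
  -- kills Q; the other two contributions tend to 0 as N → ∞, the first because ρ < p + 1 ≤ k + 1,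
  -- the second because the tails of a convergent series do.
  have hzero : ∀ k, p ≤ k → iteratedDeriv k D 0 = 0 := by
    intro k hk
    set r₀ := ‖a 0‖ / 2 with hr₀
    have hr₀0 : 0 < r₀ := half_pos ha.norm_pos
    have hr₀1 : r₀ < ‖a 0‖ := half_lt_self ha.norm_pos
    set K := r₀ ^ p / (1 - r₀ / ‖a 0‖) with hK
    have hT : Tendsto (fun N => ∑' n, (‖a (n + N)‖ ^ (p + 1))⁻¹) atTop (𝓝 0) :=
      tendsto_sum_nat_add fun n => (‖a n‖ ^ (p + 1))⁻¹
    have hlim : Tendsto (fun N => (k + 1).factorial * (2 : ℝ) *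
        ((C + 3 ^ ρ * ‖a N‖ ^ ρ) / (‖a N‖ / 2) ^ (k + 1)) +
          k.factorial * K / r₀ ^ k * ∑' n, (‖a (n + N)‖ ^ (p + 1))⁻¹) atTop (𝓝 0) := by
      have hρk : ρ < k + 1 := hρ1.trans_le (by gcongr)
      have := (((tendsto_growth_div_pow (C := C) hρk).comp ha.tendsto_norm).const_mul
        ((k + 1).factorial * (2 : ℝ))).add (hT.const_mul (k.factorial * K / r₀ ^ k))
      rw [mul_zero, mul_zero, add_zero] at this
      exact this
    rw [← norm_le_zero_iff]
    refine ge_of_tendsto hlim ?_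
    filter_upwards [hC] with N hN
    obtain ⟨f, hf, hFf, ho⟩ := exists_eq_prod_mul hF.entire hF.zeros N
    have hfne : ∀ z ∈ Metric.ball (0 : ℂ) ‖a N‖, f z ≠ 0 := by
      intro z hz
      rw [← (hf.analyticAt z).analyticOrderAt_eq_zero, ho, Set.encard_eq_zero]
      exact Set.eq_empty_of_forall_notMem fun n hn => ha.ball_subset hz hn.1 hn.2
    have hM : 0 < C + 3 ^ ρ * ‖a N‖ ^ ρ := by positivity
    have hb1 := norm_iteratedDeriv_logDeriv_le hf (ha.norm_pos' N) hM hfne (hN f hf hFf) k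
    set T : ℂ → ℂ := fun z => poleSum a p z - ∑ n ∈ Finset.range N, pole (a n) p z with hTdef
    have hTd : DifferentiableOn ℂ T V := hG.sub (DifferentiableOn.fun_sum fun n _ => hpole n)
    have hTb : ∀ z ∈ Metric.sphere (0 : ℂ) r₀, ‖T z‖ ≤ K * ∑' n, (‖a (n + N)‖ ^ (p + 1))⁻¹ := by
      intro z hz
      have hzn : ‖z‖ ≤ r₀ := by rw [mem_sphere_zero_iff_norm] at hz; exact hz.le
      have h1 : T z = ∑' n, pole (a (n + N)) p z := by
        rw [hTdef]
        have := (ha.summable_norm_pole z).of_norm.sum_add_tsum_nat_add N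
        simp only [poleSum]
        rw [← this, add_sub_cancel_left]
      have hs := ((summable_nat_add_iff N).2 (summable_pow_succ ha)).mul_left K
      rw [h1, ← tsum_mul_left]
      exact tsum_of_norm_bounded hs.hasSum fun n =>
        norm_circle_pole_le ha hr₀0 hr₀1 (n + N) p hzn
    have hb2 := Complex.norm_iteratedDeriv_le_of_forall_mem_sphere_norm_le k hr₀0
      (((hTd.mono hball).mono (Metric.closedBall_subset_ball hr₀1)).diffContOnCl_ball subset_rfl)
      hTb
    set Q : ℂ → ℂ := fun z =>
      ∑ j ∈ Finset.range p, (∑ n ∈ Finset.range N, 1 / a n ^ (j + 1)) * z ^ j with hQ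
    have hloc : D =ᶠ[𝓝 0] fun z => logDeriv f z - T z - Q z := by
      filter_upwards [Metric.isOpen_ball.mem_nhds h00] with z hz
      have hne : ∀ n, z - a n ≠ 0 := fun n =>
        sub_ne_zero.2 (ha.ball_subset hz (Nat.zero_le n)).symm
      have hzN : z ∈ Metric.ball (0 : ℂ) ‖a N‖ :=
        Metric.ball_subset_ball (ha.norm_mono (Nat.zero_le N)) hz
      have h1 : logDeriv F z = ∑ n ∈ Finset.range N, (z - a n)⁻¹ + logDeriv f z := by
        rw [funext hFf, logDeriv_mul (f := fun z => ∏ n ∈ Finset.range N, (z - a n)) (g := f) z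
          (Finset.prod_ne_zero_iff.2 fun n _ => hne n) (hfne z hzN) (by fun_prop) (hf z),
          logDeriv_prod (f := fun n z => z - a n) (fun n _ => hne n) (fun n _ => by fun_prop)]
        congr 1
        refine Finset.sum_congr rfl fun n _ => ?_
        simp [logDeriv_apply]
      have h2 : ∑ n ∈ Finset.range N, pole (a n) p z =
          ∑ n ∈ Finset.range N, (z - a n)⁻¹ + Q z := by
        simp only [pole_eq_inv_add_sum (ha.ne_zero _) (hne _), Finset.sum_add_distrib]
        congr 1
        rw [Finset.sum_comm, hQ]
        refine Finset.sum_congr rfl fun j _ => ?_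
        rw [Finset.sum_mul]
        refine Finset.sum_congr rfl fun n _ => ?_
        ring
      simp only [hD, hTdef, h1, h2]
      ring
    have hcf : ContDiffAt ℂ k (logDeriv f) 0 := by
      have hfN : (0 : ℂ) ∈ Metric.ball (0 : ℂ) ‖a N‖ := Metric.mem_ball_self (ha.norm_pos' N)
      exact (DifferentiableOn.analyticAt (fun z hz => ((hf.deriv z).div (hf z)
        (hfne z hz)).differentiableWithinAt) (Metric.isOpen_ball.mem_nhds hfN)).contDiffAt
    have hcT : ContDiffAt ℂ k T 0 := (hTd.analyticAt (hVo.mem_nhds (hball h00))).contDiffAt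
    have hcQ : ContDiffAt ℂ k Q 0 := by rw [hQ]; fun_prop
    rw [hloc.iteratedDeriv_eq k, iteratedDeriv_fun_sub (hcf.sub hcT) hcQ,
      iteratedDeriv_fun_sub hcf hcT, hQ, iteratedDeriv_sum_pow_zero _ hk, sub_zero]
    refine (norm_sub_le _ _).trans (add_le_add (hb1.trans_eq ?_) (hb2.trans_eq ?_))
    · ring
    · ring
  obtain ⟨c, hc⟩ := eq_sum_pow_of_iteratedDeriv_eq_zero (hDd.mono hball) hzero
  refine ⟨c, fun z hz => ?_⟩
  -- The plane minus a countable set is connected, so the identity near 0 extends to the complement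
  -- of the zeros.
  have hconn : IsPreconnected V :=
    ((Set.countable_range a).isPathConnected_compl_of_one_lt_rank (by
      rw [Complex.rank_real_complex]; exact Cardinal.one_lt_two)).isConnected.isPreconnected
  have hP : Differentiable ℂ fun z : ℂ => ∑ j ∈ Finset.range p, c j * z ^ j := by fun_prop
  have := (hDd.analyticOnNhd hVo).eqOn_of_preconnected_of_eventuallyEq
    (hP.differentiableOn.analyticOnNhd hVo) hconn (hball h00) (by
      filter_upwards [Metric.isOpen_ball.mem_nhds h00] with z hz
      exact hc z hz) hz
  exact sub_eq_iff_eq_add.1 this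

/-! ### The integral representations -/

theorem rayIntegrand_eq_rayTerm (hF : Differentiable ℂ F) (s : ℂ) :
    rayIntegrand F Ψ s = rayTerm (logDeriv F) Ψ s := by
  ext t
  have h1 : HasDerivAt (fun u : ℂ => F (u * Complex.exp ((Ψ : ℂ) * Complex.I)))
      (deriv F ((t : ℂ) * Complex.exp ((Ψ : ℂ) * Complex.I)) *
        (1 * Complex.exp ((Ψ : ℂ) * Complex.I))) (t : ℂ) :=
    (hF _).hasDerivAt.comp (t : ℂ) ((hasDerivAt_id (t : ℂ)).mul_const _)
  rw [rayIntegrand, rayTerm, logDeriv_apply, logDeriv_apply, h1.comp_ofReal.deriv]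
  ring

theorem norm_sum_pow_le (c : ℕ → ℂ) (p : ℕ) {R : ℝ} (hR : 1 ≤ R) {z : ℂ} (hz : ‖z‖ = R) :
    R * ‖∑ j ∈ Finset.range p, c j * z ^ j‖ ≤ (∑ j ∈ Finset.range p, ‖c j‖) * R ^ (p : ℝ) := by
  rw [Real.rpow_natCast, Finset.sum_mul]
  calc R * ‖∑ j ∈ Finset.range p, c j * z ^ j‖
      ≤ R * ∑ j ∈ Finset.range p, ‖c j‖ * R ^ j := by
        gcongr
        refine norm_sum_le_of_le _ fun j _ => ?_
        rw [norm_mul, norm_pow, hz]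
    _ = ∑ j ∈ Finset.range p, ‖c j‖ * R ^ (j + 1) := by
        rw [Finset.mul_sum]
        exact Finset.sum_congr rfl fun j _ => by ring
    _ ≤ _ := Finset.sum_le_sum fun j hj => mul_le_mul_of_nonneg_left
        (pow_le_pow_right₀ hR (Finset.mem_range.1 hj)) (norm_nonneg _)

theorem integrableOn_rayTerm_sum_pow (c : ℕ → ℂ) {p : ℕ} {s : ℂ} (hs : p < s.re) {R : ℝ}
    (hR : 0 < R) :
    MeasureTheory.IntegrableOn
      (rayTerm (fun z => ∑ j ∈ Finset.range p, c j * z ^ j) Ψ s) (Set.Ioi R) := by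
  have hdom : MeasureTheory.IntegrableOn
      (fun t : ℝ => ∑ j ∈ Finset.range p, ‖c j‖ * t ^ (-s.re + j)) (Set.Ioi R) := by
    refine MeasureTheory.integrable_finsetSum _ fun j hj => ?_
    refine MeasureTheory.Integrable.const_mul (integrableOn_Ioi_rpow_of_lt ?_ hR) _
    have : (j : ℝ) + 1 ≤ p := by exact_mod_cast Finset.mem_range.1 hj
    linarith
  refine MeasureTheory.Integrable.mono' hdom ?_
    (MeasureTheory.ae_restrict_of_forall_mem measurableSet_Ioi fun t ht => ?_)
  · refine ContinuousOn.aestronglyMeasurable (fun t ht => ?_) measurableSet_Ioi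
    have ht0 : 0 < t := hR.trans ht
    have h1 := Complex.continuousAt_ofReal_cpow_const t (-s) (Or.inr ht0.ne')
    unfold rayTerm
    exact (h1.mul (by fun_prop)).continuousWithinAt
  · have ht0 : 0 < t := hR.trans ht
    rw [rayTerm, norm_mul, norm_mul, Complex.norm_exp_ofReal_mul_I, one_mul,
      Complex.norm_cpow_eq_rpow_re_of_pos ht0, Complex.neg_re]
    have h1 : ‖∑ j ∈ Finset.range p, c j * ((t : ℂ) * Complex.exp (Ψ * Complex.I)) ^ j‖ ≤
        ∑ j ∈ Finset.range p, ‖c j‖ * t ^ j := by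
      refine norm_sum_le_of_le _ fun j _ => ?_
      rw [norm_mul, norm_pow, norm_mul, Complex.norm_exp_ofReal_mul_I, mul_one, Complex.norm_real,
        Real.norm_of_nonneg ht0.le]
    refine (mul_le_mul_of_nonneg_left h1 (by positivity)).trans_eq ?_
    rw [Finset.mul_sum]
    refine Finset.sum_congr rfl fun j _ => ?_
    rw [Real.rpow_add ht0, Real.rpow_natCast]
    ring

theorem IsZetaSequence.ray_notMem (ha : IsZetaSequence a α Ψ) {t : ℝ} (ht : 0 ≤ t) :
    (t : ℂ) * Complex.exp ((Ψ : ℂ) * Complex.I) ∉ Set.range a :=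
  fun ⟨n, hn⟩ => ha.ray_ne n ht hn.symm

/-- The representation on a ray and a circle. -/
theorem zeta_eq_keyhole (ha : IsZetaSequence a α Ψ) (hF : IsMinimalCharacteristic a α F)
    {R : ℝ} {s : ℂ} (hR : 0 < R) (hRa : R < ‖a 0‖) (hs : α < s.re) :
    MeasureTheory.IntegrableOn (rayIntegrand F Ψ s) (Set.Ioi R) ∧
    IntervalIntegrable (circleIntegrand F Ψ R s) MeasureTheory.volume (Ψ - 2 * Real.pi) Ψ ∧
    zeta a Ψ s = rayFactor Ψ s * (∫ t in Set.Ioi R, rayIntegrand F Ψ s t) -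
      1 / (2 * (Real.pi : ℂ) * Complex.I) *
        ∫ θ in (Ψ - 2 * Real.pi)..Ψ, circleIntegrand F Ψ R s θ := by
  obtain ⟨c, hc⟩ := hF.exists_logDeriv_eq ha
  set p := ⌊α⌋₊ with hp
  have hps : (p : ℝ) < s.re := (Nat.floor_le ha.exponent_nonneg).trans_lt hs
  set Q : ℂ → ℂ := fun z => ∑ j ∈ Finset.range p, c j * z ^ j with hQ
  have hQd : Differentiable ℂ Q := by rw [hQ]; fun_prop
  obtain ⟨h1, h2, h3⟩ := zeta_eq_keyhole_poleSum ha hR hRa hs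
  have hQi : MeasureTheory.IntegrableOn (rayTerm Q Ψ s) (Set.Ioi R) :=
    integrableOn_rayTerm_sum_pow c hps hR
  have hQc : IntervalIntegrable (circleTerm Q Ψ R s) MeasureTheory.volume (Ψ - 2 * Real.pi) Ψ :=
    circleTerm_intervalIntegrable hR hQd.continuous.continuousOn s
  have hQ0 := keyhole_entire_Ioi ha.direction hQd (s := s) hR hps (by
    filter_upwards [eventually_ge_atTop 1] with R hR z hz
    exact norm_sum_pow_le c p hR hz) hQi
  have eray : Set.EqOn (fun t => rayTerm Q Ψ s t + rayTerm (poleSum a p) Ψ s t)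
      (rayIntegrand F Ψ s) (Set.Ioi R) := by
    intro t ht
    have ht0 : 0 < t := hR.trans ht
    simp only [rayIntegrand_eq_rayTerm hF.entire, rayTerm, hc _ (ha.ray_notMem ht0.le), hQ]
    ring
  have ecirc : (fun θ => circleTerm Q Ψ R s θ + circleTerm (poleSum a p) Ψ R s θ) =
      circleIntegrand F Ψ R s := by
    ext θ
    have hmem : circleMap 0 R θ ∉ Set.range a := by
      rintro ⟨n, hn⟩
      have h4 : ‖a 0‖ ≤ ‖a n‖ := ha.norm_mono (Nat.zero_le n)
      have h5 : ‖circleMap 0 R θ‖ = R := by simp [abs_of_pos hR]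
      rw [hn] at h4
      linarith
    simp only [circleIntegrand, circleTerm, hc _ hmem, hQ]
    ring
  refine ⟨MeasureTheory.IntegrableOn.congr_fun (hQi.add h1) eray measurableSet_Ioi, ?_, ?_⟩
  · rw [← ecirc]
    exact hQc.add h2
  · rw [h3, ← ecirc, intervalIntegral.integral_add hQc h2,
      ← MeasureTheory.setIntegral_congr_fun measurableSet_Ioi eray,
      MeasureTheory.integral_add hQi h1]
    linear_combination -hQ0

/-- Without a polynomial part in F'/F, the integrand on the ray is exactly that of the pole sum,
which is integrable down to zero. -/
theorem zeta_eq_ray (ha : IsZetaSequence a α Ψ) (hF : Differentiable ℂ F)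
    (h : ∀ z ∉ Set.range a, logDeriv F z = poleSum a ⌊α⌋₊ z) {s : ℂ} (hs : α < s.re)
    (hs' : s.re < ⌊α⌋₊ + 1) :
    MeasureTheory.IntegrableOn (rayIntegrand F Ψ s) (Set.Ioi 0) ∧
    zeta a Ψ s = rayFactor Ψ s * ∫ t in Set.Ioi (0 : ℝ), rayIntegrand F Ψ s t := by
  obtain ⟨h1, h2⟩ := zeta_eq_ray_poleSum ha hs hs'
  have eray : Set.EqOn (rayTerm (poleSum a ⌊α⌋₊) Ψ s) (rayIntegrand F Ψ s) (Set.Ioi 0) := by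
    intro t ht
    simp only [rayIntegrand_eq_rayTerm hF, rayTerm, h _ (ha.ray_notMem (le_of_lt ht))]
  refine ⟨h1.congr_fun eray measurableSet_Ioi, ?_⟩
  rw [h2, MeasureTheory.setIntegral_congr_fun measurableSet_Ioi eray]

end SeqZeta

end

theorem mainTheorem3 (a : ℕ → ℂ) (α Ψ : ℝ) (ha : SeqZeta.IsZetaSequence a α Ψ) :
    -- the representation on the ray from `R` to infinity and the circle of radius `R`
    (∀ F : ℂ → ℂ, SeqZeta.IsMinimalCharacteristic a α F →
      (∀ (R : ℝ) (s : ℂ), 0 < R → R < ‖a 0‖ → α < s.re →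
        Summable (fun n => SeqZeta.cutPow Ψ (a n) (-s)) ∧
        MeasureTheory.IntegrableOn (SeqZeta.rayIntegrand F Ψ s) (Set.Ioi R) ∧
        IntervalIntegrable (SeqZeta.circleIntegrand F Ψ R s) MeasureTheory.volume
          (Ψ - 2 * Real.pi) Ψ ∧
        SeqZeta.zeta a Ψ s =
          SeqZeta.rayFactor Ψ s * (∫ t in Set.Ioi R, SeqZeta.rayIntegrand F Ψ s t)
            - 1 / (2 * (Real.pi : ℂ) * Complex.I) *
              ∫ θ in (Ψ - 2 * Real.pi)..Ψ, SeqZeta.circleIntegrand F Ψ R s θ) ∧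
      -- the representation on the whole ray, for exponent of convergence below one
      (α < 1 → ∀ s : ℂ, α < s.re → s.re < 1 →
        MeasureTheory.IntegrableOn (SeqZeta.rayIntegrand F Ψ s) (Set.Ioi 0) ∧
        SeqZeta.zeta a Ψ s =
          SeqZeta.rayFactor Ψ s * ∫ t in Set.Ioi (0 : ℝ), SeqZeta.rayIntegrand F Ψ s t)) ∧
    -- the representation on the whole ray, for the Hadamard product
    (∀ s : ℂ, α < s.re → s.re < (⌊α⌋₊ : ℝ) + 1 →
      MeasureTheory.IntegrableOn
        (SeqZeta.rayIntegrand (SeqZeta.hadamard a α) Ψ s) (Set.Ioi 0) ∧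
      SeqZeta.zeta a Ψ s =
        SeqZeta.rayFactor Ψ s *
          ∫ t in Set.Ioi (0 : ℝ),
            SeqZeta.rayIntegrand (SeqZeta.hadamard a α) Ψ s t) := by
  refine ⟨fun F hF => ⟨fun R s hR hRa hs =>
      ⟨ha.summable_cutPow hs, SeqZeta.zeta_eq_keyhole ha hF hR hRa hs⟩,
    fun hα s hs hs' => ?_⟩, fun s hs hs' => SeqZeta.zeta_eq_ray ha ha.differentiable_hadamard
      (fun z hz => ha.logDeriv_hadamard hz) hs hs'⟩
  -- For α < 1 the polynomial part of F'/F is an empty sum.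
  have hp : ⌊α⌋₊ = 0 := Nat.floor_eq_zero.2 hα
  refine SeqZeta.zeta_eq_ray ha hF.entire (fun z hz => ?_) hs (by rw [hp]; simpa using hs')
  obtain ⟨c, hc⟩ := hF.exists_logDeriv_eq ha
  rw [hc z hz, hp]
  simp
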